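/- **Model.** Let $\{x_k\}_{k\ge1}$ be a zero-mean second-order process in $\mathbb R^{n_x}$ with $\mathrm{Cov}[x_k,x_s]=A_kB_s^T$ for $1\le s\le k$, where $A_k,B_s\in\mathbb R^{n_x\times p}$. Let $h_k:\mathbb R^{n_x}\to\mathbb R^{n_z}$ be analytic and let $\{x_k^0\}_{k\ge1}$ be a fixed (deterministic) nominal trajectory; put $H_k=\frac{\partial h_k}{\partial x}(x_k^0)$ and $C_k=h_k(x_k^0)-H_kx_k^0$. The linearized measurements and the available observations are, for $k\ge 1$, $$z_k=\gamma_k(H_kx_k+C_k)+v_k,\qquad y_k=(1-\lambda_k)z_k+\lambda_kw_k,\qquad v_k=D_{k-1}v_{k-1}+u_{k-1},$$ where $\{\gamma_k\}_{k\ge1}$ and $\{\lambda_k\}_{k\ge1}$ are sequences of independent Bernoulli variables with means $\overline\gamma_k,\overline\lambda_k$; $D_k$ ($k\ge0$) is nonsingular; $v_0$ is a zero-mean second-order random vector; $\{u_k\}_{k\ge0}$ is a zero-mean white (uncorrelated, second-order) sequence independent of $v_0$; $\{w_k\}_{k\ge1}$ is a zero-mean white second-order sequence; and the processes $\{x_k\},\{\gamma_k\},\{v_k\},\{w_k\},\{\lambda_k\}$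 ($k\ge1$) are mutually independent. Put $E_k=D_{k-1}\cdots D_0$ and $F_k=\mathrm{Cov}[v_k](E_k^{-1})^T$. **Estimators.** $\widehat\zeta_{/L}$ denotes the least-squares linear estimator of $\zeta$ based on $y_1,\dots,y_L$, that is, the minimizer of $\mathbb E\|\zeta-Z\|^2$ over all $Z=c+\sum_{j=1}^LK_jy_j$ with $c$ a constant vector and $K_j$ constant matrices; it is unique up to almost sure equality. Let $\widehat x_{k/L}$ be that of $x_k$, let $\eta_j=y_j-\widehat y_{j/j-1}$ be the innovation, $\Sigma^\eta_j=\mathrm{Cov}[\eta_j]$, assumed nonsingular for all $j\ge1$, and let $\mathcal S^x_{k,j}=\mathbb E[x_k\eta_j^T]$. **Filter quantities.** Let $\Gamma^x_k=\overline\gamma_kH_kB_k$, $\Gamma^v_k=F_k$, $\Delta^x_k=\overline\gamma_kH_kA_k$, $\Delta^v_k=E_k$ and, for $a,b\in\{x,v\}$ and $k\ge1$, $$\Psi^a_k=(1-\overline\lambda_k)\big(\Gamma^a_k-\Delta^x_kT^{xa}_{k-1}-\Delta^v_kT^{va}_{k-1}\big)^T,$$ $$T^{ab}_k=T^{ab}_{k-1}+\Psi^a_k(\Sigma^\eta_k)^{-1}(\Psi^b_k)^T,\quad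 T^{ab}_0=0,\qquad e^a_k=e^a_{k-1}+\Psi^a_k(\Sigma^\eta_k)^{-1}\eta_k,\quad e^a_0=0.$$ **Theorem.** Let $k\ge1$ be fixed. Starting from the filter $\widehat x_{k/k}$, the fixed-point smoothers satisfy, almost surely, $$\widehat x_{k/L}=\widehat x_{k/L-1}+\mathcal S^x_{k,L}(\Sigma^\eta_L)^{-1}\eta_L,\qquad L>k,$$ with $$\mathcal S^x_{k,L}=(1-\overline\lambda_L)\Big[\big(B_k-M^x_{k,L-1}\big)(\Delta^x_L)^T-M^v_{k,L-1}(\Delta^v_L)^T\Big],\qquad L>k.$$ The matrices $M^a_{k,L}=\mathbb E[x_k(e^a_L)^T]$, $a=x,v$, satisfy the recursion $$M^a_{k,L}=M^a_{k,L-1}+\mathcal S^x_{k,L}(\Sigma^\eta_L)^{-1}(\Psi^a_L)^T,\quad L>k;\qquad M^a_{k,k}=A_kT^{xa}_k,$$ and $T^{ab}_k=\mathbb E[e^a_k(e^b_k)^T]$ for $a,b\in\{x,v\}$. -/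

import Mathlib

open MeasureTheory ProbabilityTheory Matrix

noncomputable section

namespace UncertainObs

variable {Ω : Type*} [MeasurableSpace Ω]

/-! ### Moments of random vectors -/

/-- The matrix `E[X Yᵀ]`. -/
def expOuter {m n : ℕ} (P : Measure Ω) (X : Ω → Fin m → ℝ) (Y : Ω → Fin n → ℝ) :
    Matrix (Fin m) (Fin n) ℝ :=
  Matrix.of fun i j => ∫ ω, X ω i * Y ω j ∂P

/-- The covariance matrix `Cov[X, Y] = E[(X - E X) (Y - E Y)ᵀ]`. -/
def covMat {m n : ℕ} (P : Measure Ω) (X : Ω → Fin m → ℝ) (Y : Ω → Fin n → ℝ) :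
    Matrix (Fin m) (Fin n) ℝ :=
  Matrix.of fun i j => covariance (fun ω => X ω i) (fun ω => Y ω j) P

/-- The σ-algebra generated by the process `(X k)`, `k ≥ r`. -/
abbrev processSigma {E : Type*} [MeasurableSpace E] (r : ℕ) (X : ℕ → Ω → E) : MeasurableSpace Ω :=
  ⨆ k ∈ Set.Ici r, MeasurableSpace.comap (X k) inferInstance

/-! ### Least-squares linear estimation -/

/-- The linear (with a constant term) functions of the observations `y 1, …, y L` with values
in `ℝⁿ`. -/
def linearEstimators {m : ℕ} (y : ℕ → Ω → Fin m → ℝ) (L n : ℕ) : Set (Ω → Fin n → ℝ) :=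
  {Z | ∃ (c : Fin n → ℝ) (K : ℕ → Matrix (Fin n) (Fin m) ℝ),
    Z = fun ω => c + ∑ j ∈ Finset.Icc 1 L, K j *ᵥ y j ω}

/-- Mean-square error `E ‖ζ - Z‖²` (Euclidean norm). -/
def meanSqError {n : ℕ} (P : Measure Ω) (ζ Z : Ω → Fin n → ℝ) : ℝ :=
  ∫ ω, ∑ i, (ζ ω i - Z ω i) ^ 2 ∂P

/-- `Z` is a least-squares linear estimator of `ζ` based on `y 1, …, y L`. -/
def IsLSEstimator {m n : ℕ} (P : Measure Ω) (y : ℕ → Ω → Fin m → ℝ) (L : ℕ)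
    (ζ Z : Ω → Fin n → ℝ) : Prop :=
  Z ∈ linearEstimators y L n ∧
    ∀ Z' ∈ linearEstimators y L n, meanSqError P ζ Z ≤ meanSqError P ζ Z'

/-- The least-squares linear estimator of `ζ` based on `y 1, …, y L`. For square-integrable
vectors it exists and is unique up to null sets; a version is chosen. -/
def lsEstimator {m n : ℕ} (P : Measure Ω) (y : ℕ → Ω → Fin m → ℝ) (L : ℕ)
    (ζ : Ω → Fin n → ℝ) : Ω → Fin n → ℝ :=
  Classical.epsilon (IsLSEstimator P y L ζ)

/-! ### The observation model -/

/-- The data of the model. Index `0` of `x`, `gam`, `w`, `lam`, `h`, `x0`, `A`, `B` is unused. -/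
structure Model (Ω : Type*) (nx nz p : ℕ) where
  /-- signal process -/
  x : ℕ → Ω → Fin nx → ℝ
  /-- Bernoulli variables of the uncertain observations -/
  gam : ℕ → Ω → ℝ
  /-- initial value of the time-correlated noise -/
  v0 : Ω → Fin nz → ℝ
  /-- white noise driving the time-correlated noise -/
  u : ℕ → Ω → Fin nz → ℝ
  /-- noise of the attacker -/
  w : ℕ → Ω → Fin nz → ℝ
  /-- Bernoulli variables of the attacks -/
  lam : ℕ → Ω → ℝ
  /-- transition matrices of the time-correlated noise -/
  D : ℕ → Matrix (Fin nz) (Fin nz) ℝ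
  /-- nonlinear observation functions -/
  h : ℕ → (Fin nx → ℝ) → (Fin nz → ℝ)
  /-- nominal trajectory of the signal -/
  x0 : ℕ → Fin nx → ℝ
  /-- first factor of the signal covariance -/
  A : ℕ → Matrix (Fin nx) (Fin p) ℝ
  /-- second factor of the signal covariance -/
  B : ℕ → Matrix (Fin nx) (Fin p) ℝ

/-- The superscript `a ∈ {x, v}`. -/
inductive Src
  | x
  | v

/-- Dimension of the vectors `e^a`: `p` for `a = x` and `n_z` for `a = v`. -/
abbrev dim (nz p : ℕ) : Src → ℕ
  | .x => p
  | .v => nz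

namespace Model

variable {nx nz p : ℕ} (S : Model Ω nx nz p) (P : Measure Ω)

/-- The time-correlated noise: `v_k = D_{k-1} v_{k-1} + u_{k-1}` for `k ≥ 1`. -/
def v : ℕ → Ω → Fin nz → ℝ
  | 0 => S.v0
  | k + 1 => fun ω => S.D k *ᵥ v k ω + S.u k ω

/-- The Jacobian matrix of `h_k` at the nominal point `x⁰_k`. -/
def H (k : ℕ) : Matrix (Fin nz) (Fin nx) ℝ :=
  LinearMap.toMatrix' (fderiv ℝ (S.h k) (S.x0 k) : (Fin nx → ℝ) →ₗ[ℝ] (Fin nz → ℝ))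

/-- `C_k = h_k(x⁰_k) - H_k x⁰_k`. -/
def C (k : ℕ) : Fin nz → ℝ :=
  S.h k (S.x0 k) - S.H k *ᵥ S.x0 k

/-- The linearized measurement `z_k = γ_k (H_k x_k + C_k) + v_k`. -/
def z (k : ℕ) (ω : Ω) : Fin nz → ℝ :=
  S.gam k ω • (S.H k *ᵥ S.x k ω + S.C k) + S.v k ω

/-- The available observation `y_k = (1 - λ_k) z_k + λ_k w_k`. -/
def y (k : ℕ) (ω : Ω) : Fin nz → ℝ :=
  (1 - S.lam k ω) • S.z k ω + S.lam k ω • S.w k ω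

/-- The mean of `γ_k`. -/
def gamBar (k : ℕ) : ℝ := ∫ ω, S.gam k ω ∂P

/-- The mean of `λ_k`. -/
def lamBar (k : ℕ) : ℝ := ∫ ω, S.lam k ω ∂P

/-- `E_k = D_{k-1} ⋯ D_0`. -/
def E : ℕ → Matrix (Fin nz) (Fin nz) ℝ
  | 0 => 1
  | k + 1 => S.D k * E k

/-- `F_k = Cov[v_k] (E_k⁻¹)ᵀ`. -/
def F (k : ℕ) : Matrix (Fin nz) (Fin nz) ℝ :=
  covMat P (S.v k) (S.v k) * ((S.E k)⁻¹)ᵀ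

/-- The hypotheses on the model. -/
structure Hypotheses : Prop where
  /-- the signal is a second-order zero-mean process with a factorized covariance -/
  x_meas : ∀ k, 1 ≤ k → Measurable (S.x k)
  x_memLp : ∀ k, 1 ≤ k → MemLp (S.x k) 2 P
  x_mean : ∀ k, 1 ≤ k → ∫ ω, S.x k ω ∂P = 0
  x_cov : ∀ k s, 1 ≤ s → s ≤ k → covMat P (S.x k) (S.x s) = S.A k * (S.B s)ᵀ
  /-- `γ_k` are independent Bernoulli variables -/
  gam_meas : ∀ k, 1 ≤ k → Measurable (S.gam k)
  gam_bernoulli : ∀ k, 1 ≤ k → ∀ᵐ ω ∂P, S.gam k ω = 0 ∨ S.gam k ω = 1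
  gam_indep : iIndepFun (fun (k : Set.Ici 1) => S.gam k) P
  /-- the observation functions are analytic -/
  h_analytic : ∀ k, 1 ≤ k → AnalyticOnNhd ℝ (S.h k) Set.univ
  /-- the matrices `D_k` are nonsingular -/
  D_nonsing : ∀ k, IsUnit (S.D k).det
  /-- `v_0` is a second-order zero-mean vector -/
  v0_meas : Measurable S.v0
  v0_memLp : MemLp S.v0 2 P
  v0_mean : ∫ ω, S.v0 ω ∂P = 0
  /-- `u` is a zero-mean white sequence, independent of `v_0` -/
  u_meas : ∀ k, Measurable (S.u k)
  u_memLp : ∀ k, MemLp (S.u k) 2 P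
  u_mean : ∀ k, ∫ ω, S.u k ω ∂P = 0
  u_white : ∀ k s, k ≠ s → covMat P (S.u k) (S.u s) = 0
  u_indep : Indep (processSigma 0 S.u) (MeasurableSpace.comap S.v0 inferInstance) P
  /-- `w` is a zero-mean white sequence -/
  w_meas : ∀ k, 1 ≤ k → Measurable (S.w k)
  w_memLp : ∀ k, 1 ≤ k → MemLp (S.w k) 2 P
  w_mean : ∀ k, 1 ≤ k → ∫ ω, S.w k ω ∂P = 0
  w_white : ∀ k s, 1 ≤ k → 1 ≤ s → k ≠ s → covMat P (S.w k) (S.w s) = 0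
  /-- `λ_k` are independent Bernoulli variables -/
  lam_meas : ∀ k, 1 ≤ k → Measurable (S.lam k)
  lam_bernoulli : ∀ k, 1 ≤ k → ∀ᵐ ω ∂P, S.lam k ω = 0 ∨ S.lam k ω = 1
  lam_indep : iIndepFun (fun (k : Set.Ici 1) => S.lam k) P
  /-- the five processes are mutually independent -/
  indep : iIndep (![processSigma 1 S.x, processSigma 1 S.gam, processSigma 1 S.v,
    processSigma 1 S.w, processSigma 1 S.lam] : Fin 5 → MeasurableSpace Ω) P

/-! ### Estimators and innovations -/

/-- `x̂_{k/L}`, the least-squares linear estimator of `x_k` based on `y_1, …, y_L`. -/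
def xhat (k L : ℕ) : Ω → Fin nx → ℝ :=
  lsEstimator P S.y L (S.x k)

/-- The innovation `η_j = y_j - ŷ_{j/j-1}`, `j ≥ 1`. -/
def innov (j : ℕ) (ω : Ω) : Fin nz → ℝ :=
  S.y j ω - lsEstimator P S.y (j - 1) (S.y j) ω

/-- The innovation covariance `Σ^η_j = Cov[η_j]`. -/
def innovCov (j : ℕ) : Matrix (Fin nz) (Fin nz) ℝ :=
  covMat P (S.innov P j) (S.innov P j)

/-- `S^x_{k,j} = E[x_k η_jᵀ]`. -/
def crossInnov (k j : ℕ) : Matrix (Fin nx) (Fin nz) ℝ :=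
  expOuter P (S.x k) (S.innov P j)

/-! ### Quantities of the filtering algorithm -/

/-- `Γ^x_k = γ̄_k H_k B_k` and `Γ^v_k = F_k`. -/
def Gam (k : ℕ) : (a : Src) → Matrix (Fin nz) (Fin (dim nz p a)) ℝ
  | .x => S.gamBar P k • (S.H k * S.B k)
  | .v => S.F P k

/-- `Δ^x_k = γ̄_k H_k A_k` and `Δ^v_k = E_k`. -/
def Del (k : ℕ) : (a : Src) → Matrix (Fin nz) (Fin (dim nz p a)) ℝ
  | .x => S.gamBar P k • (S.H k * S.A k)
  | .v => S.E k

/-- `(1 - λ̄_k) (Γ^a_k - Δ^x_k T^{xa} - Δ^v_k T^{va})ᵀ` for given matrices `T^{ab}`. -/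
def psiOf (k : ℕ) (T : (a b : Src) → Matrix (Fin (dim nz p a)) (Fin (dim nz p b)) ℝ) (a : Src) :
    Matrix (Fin (dim nz p a)) (Fin nz) ℝ :=
  (1 - S.lamBar P k) •
    (S.Gam P k a - S.Del P k .x * T .x a - S.Del P k .v * T .v a)ᵀ

/-- `T^{ab}_k = T^{ab}_{k-1} + Ψ^a_k (Σ^η_k)⁻¹ (Ψ^b_k)ᵀ` for `k ≥ 1`, and `T^{ab}_0 = 0`. -/
def T : ℕ → (a b : Src) → Matrix (Fin (dim nz p a)) (Fin (dim nz p b)) ℝ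
  | 0 => fun _ _ => 0
  | k + 1 => fun a b =>
      T k a b + S.psiOf P (k + 1) (T k) a * (S.innovCov P (k + 1))⁻¹ *
        (S.psiOf P (k + 1) (T k) b)ᵀ

/-- `Ψ^a_k = (1 - λ̄_k) (Γ^a_k - Δ^x_k T^{xa}_{k-1} - Δ^v_k T^{va}_{k-1})ᵀ`, `k ≥ 1`. -/
def Psi (k : ℕ) (a : Src) : Matrix (Fin (dim nz p a)) (Fin nz) ℝ :=
  S.psiOf P k (S.T P (k - 1)) a

/-- `e^a_k = e^a_{k-1} + Ψ^a_k (Σ^η_k)⁻¹ η_k` for `k ≥ 1`, and `e^a_0 = 0`. -/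
def e (a : Src) : ℕ → Ω → Fin (dim nz p a) → ℝ
  | 0 => 0
  | k + 1 => fun ω =>
      e a k ω + (S.Psi P (k + 1) a * (S.innovCov P (k + 1))⁻¹) *ᵥ S.innov P (k + 1) ω

/-- `M^a_{k,L} = E[x_k (e^a_L)ᵀ]`. -/
def M (a : Src) (k L : ℕ) : Matrix (Fin nx) (Fin (dim nz p a)) ℝ :=
  expOuter P (S.x k) (S.e P a L)

end Model

end UncertainObs

end

noncomputable section

set_option linter.unusedSectionVars false

namespace UncertainObs

variable {Ω : Type*} [MeasurableSpace Ω]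

/-! The argument is the innovation approach. A linear function of `y 1, …, y L` is a least-squares
estimator of `ζ` as soon as it has the mean of `ζ` and the same covariance with every observation
(`IsLinProj`). One more observation changes such a projection only along the innovation `η`, which
is uncorrelated with the past, and the gain is `Cov[ζ, η] Cov[η]⁻¹` (`IsLinProj.update`).
Nonsingular innovation covariances therefore give both existence of the estimators and the smoother
update; the rest is computing `Cov[ζ, η]`.

The computation rests on separable covariances. Independence of the five processes gives, for `j <
k`, `Cov[y_k, y_j] = (1 - λ̄_k)(1 - λ̄_j)(Δ^x_k Γ^x_jᵀ + Δ^v_k Γ^v_jᵀ)`, and `Cov[x_k, y_j] = (1 -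
λ̄_j) A_k Γ^x_jᵀ` for `j ≤ k`. In each case the dependence on the later index leaves through a fixed
left factor `G`. `covMat_innov_eq` transfers this from observations to innovations: `Cov[ζ, η_j] =
G^x Ψ^x_j + G^v Ψ^v_j`. Summing over `j`, estimators become affine functions of `e^x` and `e^v`; in
particular the predictor of `y_j` is its mean plus `(1 - λ̄_j)(Δ^x_j e^x_{j-1} + Δ^v_j e^v_{j-1})`.

For `L > k` the factorization of `Cov[x_k, y_L]` switches to `(1 - λ̄_L) B_k Δ^x_Lᵀ`, so
`covMat_innov_eq` no longer covers `x_k`. The formula for the predictor of `y_L` still holds, and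
subtracting its covariance with `x_k`, which is expressed by the `M^a_{k,L-1}`, gives the gain
(`covMat_innov`, `crossInnov_eq`). -/

/-- All the coordinates of the random vector are square-integrable. -/
def SecondOrder {n : ℕ} (P : Measure Ω) (X : Ω → Fin n → ℝ) : Prop :=
  ∀ i, MemLp (fun ω => X ω i) 2 P

/-- The mean vector, coordinate by coordinate. -/
def mean {n : ℕ} (P : Measure Ω) (X : Ω → Fin n → ℝ) : Fin n → ℝ :=
  fun i => ∫ ω, X ω i ∂P

/-! ### Bilinear calculus of means and covariance matrices. -/

section Moments

variable {P : Measure Ω} [IsProbabilityMeasure P] {l m n : ℕ}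

theorem secondOrder_of_memLp {X : Ω → Fin n → ℝ} (h : MemLp X 2 P) : SecondOrder P X :=
  fun i => MemLp.eval h i

theorem mean_eq_integral {X : Ω → Fin n → ℝ} (h : SecondOrder P X) :
    mean P X = ∫ ω, X ω ∂P := by
  funext i
  exact (eval_integral (fun j => (h j).integrable (by norm_num)) i).symm

namespace SecondOrder

theorem const (c : Fin n → ℝ) : SecondOrder P fun _ => c := fun _ => memLp_const _

theorem add {X Y : Ω → Fin n → ℝ} (hX : SecondOrder P X) (hY : SecondOrder P Y) :
    SecondOrder P fun ω => X ω + Y ω := fun i => (hX i).add (hY i)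

theorem sub {X Y : Ω → Fin n → ℝ} (hX : SecondOrder P X) (hY : SecondOrder P Y) :
    SecondOrder P fun ω => X ω - Y ω := fun i => (hX i).sub (hY i)

theorem mulVec {X : Ω → Fin n → ℝ} (hX : SecondOrder P X) (K : Matrix (Fin m) (Fin n) ℝ) :
    SecondOrder P fun ω => K *ᵥ X ω := fun i => by
  simp only [Matrix.mulVec, dotProduct]
  exact memLp_finsetSum _ fun j _ => (hX j).const_mul _

theorem congr {X Y : Ω → Fin n → ℝ} (hX : SecondOrder P X) (h : X =ᵐ[P] Y) :
    SecondOrder P Y := fun i => (memLp_congr_ae (by filter_upwards [h] with ω e; rw [e])).1 (hX i)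

theorem sum {ι : Type*} (s : Finset ι) {X : ι → Ω → Fin n → ℝ}
    (hX : ∀ j ∈ s, SecondOrder P (X j)) : SecondOrder P fun ω => ∑ j ∈ s, X j ω := fun i => by
  simp only [Finset.sum_apply]
  exact memLp_finsetSum _ fun j hj => hX j hj i

end SecondOrder

theorem covMat_congr_left {X X' : Ω → Fin m → ℝ} {Y : Ω → Fin n → ℝ} (h : X =ᵐ[P] X') :
    covMat P X Y = covMat P X' Y := by
  ext i j
  simp only [covMat, of_apply]
  have hi : (fun ω => X ω i) =ᵐ[P] fun ω => X' ω i := by filter_upwards [h] with ω e; rw [e]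
  unfold covariance
  rw [integral_congr_ae hi]
  refine integral_congr_ae ?_
  filter_upwards [hi] with ω e
  rw [e]

theorem transpose_covMat (X : Ω → Fin m → ℝ) (Y : Ω → Fin n → ℝ) :
    (covMat P X Y)ᵀ = covMat P Y X := by
  ext i j
  simp only [covMat, of_apply, transpose_apply]
  exact covariance_comm _ _

theorem covMat_congr_right {X : Ω → Fin m → ℝ} {Y Y' : Ω → Fin n → ℝ} (h : Y =ᵐ[P] Y') :
    covMat P X Y = covMat P X Y' := by
  rw [← transpose_covMat, covMat_congr_left h, transpose_covMat]

theorem covMat_add_left {X X' : Ω → Fin m → ℝ} {Y : Ω → Fin n → ℝ} (hX : SecondOrder P X)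
    (hX' : SecondOrder P X') (hY : SecondOrder P Y) :
    covMat P (fun ω => X ω + X' ω) Y = covMat P X Y + covMat P X' Y := by
  ext i j
  exact covariance_add_left (hX i) (hX' i) (hY j)

theorem covMat_sub_left {X X' : Ω → Fin m → ℝ} {Y : Ω → Fin n → ℝ} (hX : SecondOrder P X)
    (hX' : SecondOrder P X') (hY : SecondOrder P Y) :
    covMat P (fun ω => X ω - X' ω) Y = covMat P X Y - covMat P X' Y := by
  ext i j
  exact covariance_sub_left (hX i) (hX' i) (hY j)

theorem covMat_const_left (c : Fin m → ℝ) (Y : Ω → Fin n → ℝ) :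
    covMat P (fun _ => c) Y = 0 := by
  ext i j
  exact covariance_const_left _

theorem covMat_mulVec_left {X : Ω → Fin m → ℝ} {Y : Ω → Fin n → ℝ} (hX : SecondOrder P X)
    (hY : SecondOrder P Y) (K : Matrix (Fin l) (Fin m) ℝ) :
    covMat P (fun ω => K *ᵥ X ω) Y = K * covMat P X Y := by
  ext i j
  simp only [covMat, of_apply, Matrix.mulVec, dotProduct, Matrix.mul_apply]
  rw [covariance_fun_sum_left (fun r => (hX r).const_mul _) (hY j)]
  simp only [covariance_const_mul_left]

theorem covMat_add_right {X : Ω → Fin m → ℝ} {Y Y' : Ω → Fin n → ℝ} (hX : SecondOrder P X)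
    (hY : SecondOrder P Y) (hY' : SecondOrder P Y') :
    covMat P X (fun ω => Y ω + Y' ω) = covMat P X Y + covMat P X Y' := by
  rw [← transpose_covMat, covMat_add_left hY hY' hX, transpose_add, transpose_covMat,
    transpose_covMat]

theorem covMat_sub_right {X : Ω → Fin m → ℝ} {Y Y' : Ω → Fin n → ℝ} (hX : SecondOrder P X)
    (hY : SecondOrder P Y) (hY' : SecondOrder P Y') :
    covMat P X (fun ω => Y ω - Y' ω) = covMat P X Y - covMat P X Y' := by
  rw [← transpose_covMat, covMat_sub_left hY hY' hX, transpose_sub, transpose_covMat,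
    transpose_covMat]

theorem covMat_const_right (X : Ω → Fin m → ℝ) (c : Fin n → ℝ) :
    covMat P X (fun _ => c) = 0 := by
  rw [← transpose_covMat, covMat_const_left, transpose_zero]

theorem covMat_mulVec_right {X : Ω → Fin m → ℝ} {Y : Ω → Fin n → ℝ} (hX : SecondOrder P X)
    (hY : SecondOrder P Y) (K : Matrix (Fin l) (Fin n) ℝ) :
    covMat P X (fun ω => K *ᵥ Y ω) = covMat P X Y * Kᵀ := by
  rw [← transpose_covMat, covMat_mulVec_left hY hX, transpose_mul, transpose_covMat]

theorem covMat_sum_right {ι : Type*} (s : Finset ι) {X : Ω → Fin m → ℝ}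
    {Y : ι → Ω → Fin n → ℝ} (hX : SecondOrder P X) (hY : ∀ j ∈ s, SecondOrder P (Y j)) :
    covMat P X (fun ω => ∑ j ∈ s, Y j ω) = ∑ j ∈ s, covMat P X (Y j) := by
  ext i r
  simp only [covMat, of_apply, Matrix.sum_apply, Finset.sum_apply]
  exact covariance_fun_sum_right' (fun j hj => hY j hj r) (hX i)

theorem mean_congr {X Y : Ω → Fin n → ℝ} (h : X =ᵐ[P] Y) : mean P X = mean P Y := by
  funext i
  exact integral_congr_ae (by filter_upwards [h] with ω e; rw [e])

theorem mean_add {X Y : Ω → Fin n → ℝ} (hX : SecondOrder P X) (hY : SecondOrder P Y) :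
    mean P (fun ω => X ω + Y ω) = mean P X + mean P Y := by
  funext i
  exact integral_add ((hX i).integrable (by norm_num)) ((hY i).integrable (by norm_num))

theorem mean_sub {X Y : Ω → Fin n → ℝ} (hX : SecondOrder P X) (hY : SecondOrder P Y) :
    mean P (fun ω => X ω - Y ω) = mean P X - mean P Y := by
  funext i
  exact integral_sub ((hX i).integrable (by norm_num)) ((hY i).integrable (by norm_num))

theorem mean_const (c : Fin n → ℝ) : mean P (fun _ => c) = c := by
  funext i
  simp [mean]

theorem mean_mulVec {X : Ω → Fin n → ℝ} (hX : SecondOrder P X) (K : Matrix (Fin m) (Fin n) ℝ) :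
    mean P (fun ω => K *ᵥ X ω) = K *ᵥ mean P X := by
  funext i
  simp only [mean, Matrix.mulVec, dotProduct]
  rw [integral_finsetSum _ fun j _ => ((hX j).integrable (by norm_num)).const_mul _]
  simp only [integral_const_mul]

/-- `E[X Yᵀ] = Cov[X, Y]` when `X` has mean zero. -/
theorem expOuter_eq_covMat_of_mean_left {X : Ω → Fin m → ℝ} {Y : Ω → Fin n → ℝ}
    (hX : SecondOrder P X) (hY : SecondOrder P Y) (h0 : mean P X = 0) :
    expOuter P X Y = covMat P X Y := by
  ext i j
  have h := congrFun h0 i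
  simp only [mean, Pi.zero_apply] at h
  simp only [expOuter, covMat, of_apply]
  rw [covariance_eq_sub (hX i) (hY j), h, zero_mul, sub_zero]
  rfl

end Moments

/-! ### Linear least squares, normal equations and innovations. -/

section LeastSquares

variable {P : Measure Ω} [IsProbabilityMeasure P] {m n : ℕ} {y : ℕ → Ω → Fin m → ℝ}

theorem linearEstimators_mono {L L' : ℕ} (h : L ≤ L') :
    linearEstimators y L n ⊆ linearEstimators y L' n := by
  rintro Z ⟨c, K, rfl⟩
  -- The family `K` is arbitrary beyond `L`, so it has to be cut off before enlarging the range.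
  refine ⟨c, fun j => if j ≤ L then K j else 0, ?_⟩
  funext ω
  congr 1
  refine Finset.sum_subset_zero_on_sdiff (Finset.Icc_subset_Icc_right h) ?_ ?_
  · intro j hj
    simp only [Finset.mem_sdiff, Finset.mem_Icc, not_and] at hj
    simp only [if_neg (hj.2 hj.1.1), zero_mulVec]
  · intro j hj
    simp only [if_pos (Finset.mem_Icc.1 hj).2]

theorem const_mem_linearEstimators (L : ℕ) (c : Fin n → ℝ) :
    (fun _ => c) ∈ linearEstimators y L n := ⟨c, 0, by simp⟩

theorem obs_mem_linearEstimators {j L : ℕ} (h1 : 1 ≤ j) (h : j ≤ L) :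
    y j ∈ linearEstimators y L m := by
  refine ⟨0, fun i => if i = j then 1 else 0, ?_⟩
  funext ω
  rw [Finset.sum_eq_single j]
  · simp
  · intro b _ hb
    simp [hb]
  · intro hj
    exact absurd (Finset.mem_Icc.2 ⟨h1, h⟩) hj

theorem add_mem_linearEstimators {L : ℕ} {Z Z' : Ω → Fin n → ℝ}
    (h : Z ∈ linearEstimators y L n) (h' : Z' ∈ linearEstimators y L n) :
    (fun ω => Z ω + Z' ω) ∈ linearEstimators y L n := by
  obtain ⟨c, K, rfl⟩ := h
  obtain ⟨c', K', rfl⟩ := h'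
  refine ⟨c + c', K + K', ?_⟩
  funext ω
  simp only [Pi.add_apply, add_mulVec, Finset.sum_add_distrib]
  abel

theorem mulVec_mem_linearEstimators {L l : ℕ} {Z : Ω → Fin n → ℝ}
    (h : Z ∈ linearEstimators y L n) (G : Matrix (Fin l) (Fin n) ℝ) :
    (fun ω => G *ᵥ Z ω) ∈ linearEstimators y L l := by
  obtain ⟨c, K, rfl⟩ := h
  refine ⟨G *ᵥ c, fun j => G * K j, ?_⟩
  funext ω
  simp only [mulVec_add, mulVec_sum, mulVec_mulVec]

theorem sub_mem_linearEstimators {L : ℕ} {Z Z' : Ω → Fin n → ℝ}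
    (h : Z ∈ linearEstimators y L n) (h' : Z' ∈ linearEstimators y L n) :
    (fun ω => Z ω - Z' ω) ∈ linearEstimators y L n := by
  simpa [neg_mulVec, sub_eq_add_neg] using
    add_mem_linearEstimators h (mulVec_mem_linearEstimators h' (-1))

theorem secondOrder_of_mem_linearEstimators (hy : ∀ j, 1 ≤ j → SecondOrder P (y j)) {L : ℕ}
    {Z : Ω → Fin n → ℝ} (h : Z ∈ linearEstimators y L n) : SecondOrder P Z := by
  obtain ⟨c, K, rfl⟩ := h
  exact (SecondOrder.const c).add
    (SecondOrder.sum _ fun j hj => (hy j (Finset.mem_Icc.1 hj).1).mulVec _)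

/-- Linear functions of the observations with the right mean and the right covariance with each
of the observations. -/
structure IsLinProj (P : Measure Ω) (y : ℕ → Ω → Fin m → ℝ) (L : ℕ) (ζ Z : Ω → Fin n → ℝ) :
    Prop where
  mem : Z ∈ linearEstimators y L n
  mean_eq : mean P Z = mean P ζ
  cov_eq : ∀ j, 1 ≤ j → j ≤ L → covMat P Z (y j) = covMat P ζ (y j)

namespace IsLinProj

variable {L : ℕ} {ζ Z : Ω → Fin n → ℝ}

theorem covMat_eq {l : ℕ} (h : IsLinProj P y L ζ Z) (hy : ∀ j, 1 ≤ j → SecondOrder P (y j))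
    (hζ : SecondOrder P ζ) {D : Ω → Fin l → ℝ} (hD : D ∈ linearEstimators y L l) :
    covMat P Z D = covMat P ζ D := by
  have hZ := secondOrder_of_mem_linearEstimators hy h.mem
  obtain ⟨c, K, rfl⟩ := hD
  have hj : ∀ j ∈ Finset.Icc 1 L, SecondOrder P fun ω => K j *ᵥ y j ω := fun j hj =>
    (hy j (Finset.mem_Icc.1 hj).1).mulVec _
  rw [covMat_add_right hZ (SecondOrder.const c) (SecondOrder.sum _ hj),
    covMat_add_right hζ (SecondOrder.const c) (SecondOrder.sum _ hj),
    covMat_const_right, covMat_const_right, covMat_sum_right _ hZ hj, covMat_sum_right _ hζ hj]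
  congr 1
  refine Finset.sum_congr rfl fun j hj => ?_
  have h1 := Finset.mem_Icc.1 hj
  rw [covMat_mulVec_right hZ (hy j h1.1), covMat_mulVec_right hζ (hy j h1.1),
    h.cov_eq j h1.1 h1.2]

/-- The error `ζ - Z` has mean zero, so its second moments with `D` are covariances, and these
vanish by the normal equations. -/
theorem integral_mul_eq_zero (h : IsLinProj P y L ζ Z) (hy : ∀ j, 1 ≤ j → SecondOrder P (y j))
    (hζ : SecondOrder P ζ) {D : Ω → Fin n → ℝ} (hD : D ∈ linearEstimators y L n) (i : Fin n) :
    ∫ ω, (ζ ω i - Z ω i) * D ω i ∂P = 0 := by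
  have hZ := secondOrder_of_mem_linearEstimators hy h.mem
  have hD' := secondOrder_of_mem_linearEstimators hy hD
  have h0 : mean P (fun ω => ζ ω - Z ω) = 0 := by
    rw [mean_sub hζ hZ, h.mean_eq, sub_self]
  have h1 := expOuter_eq_covMat_of_mean_left (hζ.sub hZ) hD' h0
  rw [covMat_sub_left hζ hZ hD', h.covMat_eq hy hζ hD, sub_self] at h1
  exact congrFun (congrFun h1 i) i

/-- Pythagoras: the cross term vanishes because the error is orthogonal to `Z - Z'`. Minimality and
uniqueness of the projection both follow from this identity. -/
theorem meanSqError_eq (h : IsLinProj P y L ζ Z) (hy : ∀ j, 1 ≤ j → SecondOrder P (y j))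
    (hζ : SecondOrder P ζ) {Z' : Ω → Fin n → ℝ} (hZ' : Z' ∈ linearEstimators y L n) :
    meanSqError P ζ Z' = meanSqError P ζ Z + meanSqError P Z Z' := by
  have hZ := secondOrder_of_mem_linearEstimators hy h.mem
  have hZ2 := secondOrder_of_mem_linearEstimators hy hZ'
  have hsq : ∀ {X Y : Ω → Fin n → ℝ}, SecondOrder P X → SecondOrder P Y → ∀ i,
      Integrable (fun ω => (X ω i - Y ω i) ^ 2) P := fun hX hY i =>
    ((hX i).sub (hY i)).integrable_sq
  have hmul : ∀ i, Integrable (fun ω => (ζ ω i - Z ω i) * (Z ω i - Z' ω i)) P := fun i =>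
    ((hζ i).sub (hZ i)).integrable_mul ((hZ i).sub (hZ2 i))
  unfold meanSqError
  rw [integral_finsetSum _ fun i _ => hsq hζ hZ2 i, integral_finsetSum _ fun i _ => hsq hζ hZ i,
    integral_finsetSum _ fun i _ => hsq hZ hZ2 i, ← Finset.sum_add_distrib]
  refine Finset.sum_congr rfl fun i _ => ?_
  have hc := h.integral_mul_eq_zero hy hζ (sub_mem_linearEstimators h.mem hZ') i
  have he : (fun ω => (ζ ω i - Z' ω i) ^ 2) = fun ω =>
      ((ζ ω i - Z ω i) ^ 2 + (Z ω i - Z' ω i) ^ 2)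
        + 2 * ((ζ ω i - Z ω i) * (Z ω i - Z' ω i)) := by
    funext ω
    ring
  simp only [Pi.sub_apply] at hc
  have hs : Integrable (fun ω => (ζ ω i - Z ω i) ^ 2 + (Z ω i - Z' ω i) ^ 2) P :=
    (hsq hζ hZ i).add (hsq hZ hZ2 i)
  rw [he, integral_add hs ((hmul i).const_mul 2), integral_add (hsq hζ hZ i) (hsq hZ hZ2 i),
    integral_const_mul, hc, mul_zero, add_zero]

theorem isLSEstimator (h : IsLinProj P y L ζ Z) (hy : ∀ j, 1 ≤ j → SecondOrder P (y j))
    (hζ : SecondOrder P ζ) : IsLSEstimator P y L ζ Z := by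
  refine ⟨h.mem, fun Z' hZ' => ?_⟩
  rw [h.meanSqError_eq hy hζ hZ', le_add_iff_nonneg_right]
  exact integral_nonneg fun ω => Finset.sum_nonneg fun i _ => sq_nonneg _

theorem ae_eq (h : IsLinProj P y L ζ Z) (hy : ∀ j, 1 ≤ j → SecondOrder P (y j))
    (hζ : SecondOrder P ζ) {Z' : Ω → Fin n → ℝ} (hZ' : IsLSEstimator P y L ζ Z') :
    Z' =ᵐ[P] Z := by
  have hZ := secondOrder_of_mem_linearEstimators hy h.mem
  have hZ2 := secondOrder_of_mem_linearEstimators hy hZ'.1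
  have hle := hZ'.2 Z h.mem
  rw [h.meanSqError_eq hy hζ hZ'.1] at hle
  have hnn : ∀ ω, 0 ≤ ∑ i, (Z ω i - Z' ω i) ^ 2 := fun ω =>
    Finset.sum_nonneg fun i _ => sq_nonneg _
  have h0 : ∫ ω, ∑ i, (Z ω i - Z' ω i) ^ 2 ∂P = 0 :=
    le_antisymm (by unfold meanSqError at hle; linarith) (integral_nonneg hnn)
  have hint : Integrable (fun ω => ∑ i, (Z ω i - Z' ω i) ^ 2) P :=
    integrable_finsetSum _ fun i _ => ((hZ i).sub (hZ2 i)).integrable_sq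
  filter_upwards [(integral_eq_zero_iff_of_nonneg hnn hint).1 h0] with ω hω
  funext i
  have := (Finset.sum_eq_zero_iff_of_nonneg fun i _ => sq_nonneg (Z ω i - Z' ω i)).1 hω i
    (Finset.mem_univ i)
  exact (sub_eq_zero.1 (pow_eq_zero_iff two_ne_zero |>.1 this)).symm

theorem lsEstimator_ae_eq (h : IsLinProj P y L ζ Z) (hy : ∀ j, 1 ≤ j → SecondOrder P (y j))
    (hζ : SecondOrder P ζ) : lsEstimator P y L ζ =ᵐ[P] Z :=
  h.ae_eq hy hζ (Classical.epsilon_spec (p := IsLSEstimator P y L ζ) ⟨Z, h.isLSEstimator hy hζ⟩)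

/-- Once a projection exists, the minimizer picked by `Classical.epsilon` agrees with it almost
surely and so satisfies the normal equations itself. -/
theorem lsEstimator (h : IsLinProj P y L ζ Z) (hy : ∀ j, 1 ≤ j → SecondOrder P (y j))
    (hζ : SecondOrder P ζ) : IsLinProj P y L ζ (lsEstimator P y L ζ) where
  mem := (Classical.epsilon_spec (p := IsLSEstimator P y L ζ) ⟨Z, h.isLSEstimator hy hζ⟩).1
  mean_eq := (mean_congr (h.lsEstimator_ae_eq hy hζ)).trans h.mean_eq
  cov_eq := fun j h1 hj =>
    (covMat_congr_left (h.lsEstimator_ae_eq hy hζ)).trans (h.cov_eq j h1 hj)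

/-- Updating a projection with the innovation `y (L + 1) - Y` of the next observation. -/
theorem update (h : IsLinProj P y L ζ Z) (hy : ∀ j, 1 ≤ j → SecondOrder P (y j))
    (hζ : SecondOrder P ζ) {Y : Ω → Fin m → ℝ} (hY : IsLinProj P y L (y (L + 1)) Y)
    {η : Ω → Fin m → ℝ} (hη : η = fun ω => y (L + 1) ω - Y ω)
    (hdet : IsUnit (covMat P η η).det) :
    IsLinProj P y (L + 1) ζ
      (fun ω => Z ω + (covMat P ζ η * (covMat P η η)⁻¹) *ᵥ η ω) := by
  have hy1 := hy (L + 1) (by omega)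
  have hZ := secondOrder_of_mem_linearEstimators hy h.mem
  have hY2 := secondOrder_of_mem_linearEstimators hy hY.mem
  have hη2 : SecondOrder P η := hη ▸ hy1.sub hY2
  -- The innovation is uncorrelated with every linear function of the first `L` observations; this
  -- drives both cases below.
  have horth : ∀ {l : ℕ} {D : Ω → Fin l → ℝ}, D ∈ linearEstimators y L l → covMat P η D = 0 := by
    intro l D hD
    rw [hη, covMat_sub_left hy1 hY2 (secondOrder_of_mem_linearEstimators hy hD),
      hY.covMat_eq hy hy1 hD, sub_self]
  refine ⟨?_, ?_, ?_⟩
  · refine add_mem_linearEstimators (linearEstimators_mono (Nat.le_succ L) h.mem)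
      (mulVec_mem_linearEstimators ?_ _)
    rw [hη]
    exact sub_mem_linearEstimators (obs_mem_linearEstimators (by omega) le_rfl)
      (linearEstimators_mono (Nat.le_succ L) hY.mem)
  · rw [mean_add hZ (hη2.mulVec _), mean_mulVec hη2, h.mean_eq, hη, mean_sub hy1 hY2, hY.mean_eq,
      sub_self, mulVec_zero, add_zero]
  · intro j h1 hj
    rw [covMat_add_left hZ (hη2.mulVec _) (hy j h1), covMat_mulVec_left hη2 (hy j h1)]
    -- For `j ≤ L` the correction is invisible. For `j = L + 1`, split `y (L + 1) = η + Y`: the gain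
    -- is chosen to match the covariance with `η`, and `Z` already matches the one with `Y`.
    rcases Nat.lt_or_ge L j with hlt | hge
    · obtain rfl : j = L + 1 := by omega
      have hsplit : y (L + 1) = fun ω => η ω + Y ω := by
        funext ω
        simp [hη]
      rw [hsplit, covMat_add_right hZ hη2 hY2, covMat_add_right hη2 hη2 hY2,
        covMat_add_right hζ hη2 hY2, horth hY.mem, h.covMat_eq hy hζ hY.mem, add_zero,
        Matrix.mul_assoc, Matrix.nonsing_inv_mul _ hdet, Matrix.mul_one,
        ← transpose_covMat, horth h.mem, transpose_zero, zero_add, add_comm]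
    · rw [h.cov_eq j h1 hge, horth (obs_mem_linearEstimators h1 hge), Matrix.mul_zero, add_zero]

end IsLinProj

/-- The innovation of the `j`-th observation. -/
def innovation (P : Measure Ω) (y : ℕ → Ω → Fin m → ℝ) (j : ℕ) (ω : Ω) : Fin m → ℝ :=
  y j ω - lsEstimator P y (j - 1) (y j) ω

theorem exists_isLinProj (hy : ∀ j, 1 ≤ j → SecondOrder P (y j))
    (hdet : ∀ j, 1 ≤ j → IsUnit (covMat P (innovation P y j) (innovation P y j)).det) (L : ℕ) :
    ∀ {n : ℕ} {ζ : Ω → Fin n → ℝ}, SecondOrder P ζ → ∃ Z, IsLinProj P y L ζ Z := by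
  induction L with
  | zero =>
    intro n ζ _
    -- With no observations the constant mean is the projection, and the covariance conditions are
    -- vacuous.
    exact ⟨fun _ => mean P ζ, const_mem_linearEstimators _ _, mean_const _, fun j _ _ => by omega⟩
  | succ L ih =>
    intro n ζ hζ
    obtain ⟨Z, hZ⟩ := ih hζ
    obtain ⟨Y, hY⟩ := ih (hy (L + 1) (by omega))
    -- The predictor `Y` is replaced by the chosen version `lsEstimator`, since `hdet` speaks of the
    -- innovation built from that version.
    exact ⟨_, hZ.update hy hζ (hY.lsEstimator hy (hy _ (by omega))) rfl (hdet (L + 1) (by omega))⟩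

theorem isLinProj_lsEstimator (hy : ∀ j, 1 ≤ j → SecondOrder P (y j))
    (hdet : ∀ j, 1 ≤ j → IsUnit (covMat P (innovation P y j) (innovation P y j)).det) (L : ℕ)
    {ζ : Ω → Fin n → ℝ} (hζ : SecondOrder P ζ) : IsLinProj P y L ζ (lsEstimator P y L ζ) :=
  let ⟨_, h⟩ := exists_isLinProj hy hdet L hζ
  h.lsEstimator hy hζ

theorem lsEstimator_succ (hy : ∀ j, 1 ≤ j → SecondOrder P (y j))
    (hdet : ∀ j, 1 ≤ j → IsUnit (covMat P (innovation P y j) (innovation P y j)).det) (L : ℕ)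
    {ζ : Ω → Fin n → ℝ} (hζ : SecondOrder P ζ) :
    lsEstimator P y (L + 1) ζ =ᵐ[P] fun ω => lsEstimator P y L ζ ω +
      (covMat P ζ (innovation P y (L + 1)) *
        (covMat P (innovation P y (L + 1)) (innovation P y (L + 1)))⁻¹) *ᵥ
          innovation P y (L + 1) ω :=
  ((isLinProj_lsEstimator hy hdet L hζ).update hy hζ
    (isLinProj_lsEstimator hy hdet L (hy (L + 1) (by omega))) rfl
      (hdet (L + 1) (by omega))).lsEstimator_ae_eq hy hζ

theorem lsEstimator_zero (hy : ∀ j, 1 ≤ j → SecondOrder P (y j))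
    {ζ : Ω → Fin n → ℝ} (hζ : SecondOrder P ζ) :
    lsEstimator P y 0 ζ =ᵐ[P] fun _ => mean P ζ :=
  IsLinProj.lsEstimator_ae_eq
    ⟨const_mem_linearEstimators _ _, mean_const _, fun j _ _ => by omega⟩ hy hζ

theorem innovation_mem_linearEstimators (hy : ∀ j, 1 ≤ j → SecondOrder P (y j))
    (hdet : ∀ j, 1 ≤ j → IsUnit (covMat P (innovation P y j) (innovation P y j)).det) {j : ℕ}
    (h1 : 1 ≤ j) : innovation P y j ∈ linearEstimators y j m :=
  sub_mem_linearEstimators (obs_mem_linearEstimators h1 le_rfl)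
    (linearEstimators_mono (Nat.sub_le j 1) (isLinProj_lsEstimator hy hdet (j - 1) (hy j h1)).mem)

theorem secondOrder_innovation (hy : ∀ j, 1 ≤ j → SecondOrder P (y j))
    (hdet : ∀ j, 1 ≤ j → IsUnit (covMat P (innovation P y j) (innovation P y j)).det) {j : ℕ}
    (h1 : 1 ≤ j) : SecondOrder P (innovation P y j) :=
  secondOrder_of_mem_linearEstimators hy (innovation_mem_linearEstimators hy hdet h1)

theorem mean_innovation (hy : ∀ j, 1 ≤ j → SecondOrder P (y j))
    (hdet : ∀ j, 1 ≤ j → IsUnit (covMat P (innovation P y j) (innovation P y j)).det) {j : ℕ}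
    (h1 : 1 ≤ j) : mean P (innovation P y j) = 0 := by
  have h := isLinProj_lsEstimator hy hdet (j - 1) (hy j h1)
  exact (mean_sub (hy j h1) (secondOrder_of_mem_linearEstimators hy h.mem)).trans
    (by rw [h.mean_eq, sub_self])

/-- The normal equations for the predictor, read as orthogonality of the innovation to the past. -/
theorem covMat_innovation_eq_zero (hy : ∀ j, 1 ≤ j → SecondOrder P (y j))
    (hdet : ∀ j, 1 ≤ j → IsUnit (covMat P (innovation P y j) (innovation P y j)).det) {j : ℕ}
    (h1 : 1 ≤ j) {D : Ω → Fin n → ℝ} (hD : D ∈ linearEstimators y (j - 1) n) :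
    covMat P (innovation P y j) D = 0 := by
  have h := isLinProj_lsEstimator hy hdet (j - 1) (hy j h1)
  exact (covMat_sub_left (hy j h1) (secondOrder_of_mem_linearEstimators hy h.mem)
    (secondOrder_of_mem_linearEstimators hy hD)).trans
      (by rw [h.covMat_eq hy (hy j h1) hD, sub_self])

end LeastSquares

/-! ### Factorization of expectations under mutual independence. -/

section Independence

variable {P : Measure Ω} [IsProbabilityMeasure P]

theorem measurable_processSigma {E : Type*} [MeasurableSpace E] {r k : ℕ} (X : ℕ → Ω → E)
    (h : r ≤ k) : Measurable[processSigma r X] (X k) :=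
  (comap_measurable (X k)).mono
    (le_iSup₂ (f := fun k (_ : k ∈ Set.Ici r) => MeasurableSpace.comap (X k) inferInstance) k h)
    le_rfl

theorem processSigma_le {E : Type*} [mE : MeasurableSpace E] {r : ℕ} {X : ℕ → Ω → E}
    (h : ∀ k, r ≤ k → Measurable (X k)) : processSigma r X ≤ ‹MeasurableSpace Ω› :=
  iSup₂_le fun k hk => (h k hk).comap_le

theorem covMat_apply {m n : ℕ} (X : Ω → Fin m → ℝ) (Y : Ω → Fin n → ℝ) (i : Fin m) (j : Fin n) :
    covMat P X Y i j = cov[fun ω => X ω i, fun ω => Y ω j; P] := rfl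

theorem covMat_eq_zero_of_indepFun {m n : ℕ} {X : Ω → Fin m → ℝ} {Y : Ω → Fin n → ℝ}
    (h : IndepFun X Y P) (hX : SecondOrder P X) (hY : SecondOrder P Y) : covMat P X Y = 0 := by
  ext i j
  have hij : IndepFun (fun ω => X ω i) (fun ω => Y ω j) P :=
    h.comp (measurable_pi_apply i) (measurable_pi_apply j)
  exact hij.covariance_eq_zero (hX i) (hY j)

theorem integral_prod_of_iIndep {ι : Type*} [Fintype ι] {m : ι → MeasurableSpace Ω}
    (h : iIndep m P) (hm : ∀ i, m i ≤ ‹MeasurableSpace Ω›) {f : ι → Ω → ℝ}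
    (hf : ∀ i, Measurable[m i] (f i)) : ∫ ω, ∏ i, f i ω ∂P = ∏ i, ∫ ω, f i ω ∂P :=
  iIndepFun.integral_fun_prod_eq_prod_integral
    ((iIndepFun_iff_iIndep _ _ _).2 (iIndep_of_iIndep_of_le h fun i => (hf i).comap_le))
    fun i => ((hf i).mono (hm i) le_rfl).aestronglyMeasurable

theorem integral_mul_of_iIndep {m : Fin 5 → MeasurableSpace Ω} (h : iIndep m P)
    (hm : ∀ i, m i ≤ ‹MeasurableSpace Ω›) {a b c d e : Ω → ℝ} (ha : Measurable[m 0] a)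
    (hb : Measurable[m 1] b) (hc : Measurable[m 2] c) (hd : Measurable[m 3] d)
    (he : Measurable[m 4] e) :
    ∫ ω, a ω * b ω * c ω * d ω * e ω ∂P =
      (∫ ω, a ω ∂P) * (∫ ω, b ω ∂P) * (∫ ω, c ω ∂P) * (∫ ω, d ω ∂P) * ∫ ω, e ω ∂P := by
  have := integral_prod_of_iIndep h hm (f := ![a, b, c, d, e]) (by
    intro i
    fin_cases i
    exacts [ha, hb, hc, hd, he])
  simpa [Fin.prod_univ_five] using this

end Independence

namespace Model

variable {nx nz p : ℕ} {S : Model Ω nx nz p} {P : Measure Ω} [IsProbabilityMeasure P]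

namespace Hypotheses

/-! ### Moments of the time-correlated noise and of the primitive processes. -/

section CorrelatedNoise

theorem secondOrder_u (hS : S.Hypotheses P) (k : ℕ) : SecondOrder P (S.u k) :=
  secondOrder_of_memLp (hS.u_memLp k)

theorem measurable_v (hS : S.Hypotheses P) (k : ℕ) : Measurable (S.v k) := by
  induction k with
  | zero => exact hS.v0_meas
  | succ k ih =>
    exact (((continuous_const.matrix_mulVec continuous_id).measurable).comp ih).add (hS.u_meas k)

theorem secondOrder_v (hS : S.Hypotheses P) (k : ℕ) : SecondOrder P (S.v k) := by
  induction k with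
  | zero => exact secondOrder_of_memLp hS.v0_memLp
  | succ k ih => exact (ih.mulVec _).add (hS.secondOrder_u k)

theorem mean_v (hS : S.Hypotheses P) (k : ℕ) : mean P (S.v k) = 0 := by
  induction k with
  | zero =>
    exact (mean_eq_integral (secondOrder_of_memLp hS.v0_memLp)).trans hS.v0_mean
  | succ k ih =>
    refine (mean_add ((hS.secondOrder_v k).mulVec _) (hS.secondOrder_u k)).trans ?_
    rw [mean_mulVec (hS.secondOrder_v k), ih, mean_eq_integral (hS.secondOrder_u k), hS.u_mean,
      mulVec_zero, add_zero]

/-- `v_s` is a linear combination of `v_0` and `u_0, …, u_{s-1}`; independence from `v_0` and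
whiteness handle the two kinds of terms. -/
theorem covMat_u_v (hS : S.Hypotheses P) {j s : ℕ} (h : s ≤ j) :
    covMat P (S.u j) (S.v s) = 0 := by
  induction s with
  | zero =>
    refine covMat_eq_zero_of_indepFun ?_ (hS.secondOrder_u j) (hS.secondOrder_v 0)
    rw [IndepFun_iff_Indep]
    exact indep_of_indep_of_le_left hS.u_indep (measurable_processSigma S.u (Nat.zero_le j)).comap_le
  | succ s ih =>
    refine (covMat_add_right (hS.secondOrder_u j) ((hS.secondOrder_v s).mulVec (S.D s))
      (hS.secondOrder_u s)).trans ?_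
    rw [covMat_mulVec_right (hS.secondOrder_u j) (hS.secondOrder_v s), ih (by omega),
      hS.u_white j s (by omega), Matrix.zero_mul, add_zero]

theorem isUnit_det_E (hS : S.Hypotheses P) (k : ℕ) : IsUnit (S.E k).det := by
  induction k with
  | zero => simp [Model.E]
  | succ k ih =>
    rw [Model.E, det_mul]
    exact (hS.D_nonsing k).mul ih

/-- The noise covariance is separable like that of the signal: passing from `k` to `k + 1`
multiplies it by `D_k` on the left, which turns `E_k` into `E_{k+1}`, and `F_s` is normalized so
that the diagonal case holds. -/
theorem covMat_v (hS : S.Hypotheses P) {k s : ℕ} (h : s ≤ k) :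
    covMat P (S.v k) (S.v s) = S.E k * (S.F P s)ᵀ := by
  induction k, h using Nat.le_induction with
  | base =>
    rw [F, transpose_mul, transpose_transpose, transpose_covMat, ← Matrix.mul_assoc,
      Matrix.mul_nonsing_inv _ (hS.isUnit_det_E s), Matrix.one_mul]
  | succ k hk ih =>
    refine (covMat_add_left ((hS.secondOrder_v k).mulVec (S.D k)) (hS.secondOrder_u k)
      (hS.secondOrder_v s)).trans ?_
    rw [covMat_mulVec_left (hS.secondOrder_v k) (hS.secondOrder_v s), hS.covMat_u_v hk, ih, add_zero,
      Model.E, Matrix.mul_assoc]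

end CorrelatedNoise

theorem secondOrder_x (hS : S.Hypotheses P) {k : ℕ} (hk : 1 ≤ k) : SecondOrder P (S.x k) :=
  secondOrder_of_memLp (hS.x_memLp k hk)

theorem mean_x (hS : S.Hypotheses P) {k : ℕ} (hk : 1 ≤ k) : mean P (S.x k) = 0 :=
  (mean_eq_integral (hS.secondOrder_x hk)).trans (hS.x_mean k hk)

theorem covMat_x_comm (hS : S.Hypotheses P) {k s : ℕ} (hk : 1 ≤ k) (h : k ≤ s) :
    covMat P (S.x k) (S.x s) = S.B k * (S.A s)ᵀ := by
  rw [← transpose_covMat, hS.x_cov s k hk h, transpose_mul, transpose_transpose]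

theorem secondOrder_w (hS : S.Hypotheses P) {k : ℕ} (hk : 1 ≤ k) : SecondOrder P (S.w k) :=
  secondOrder_of_memLp (hS.w_memLp k hk)

theorem mean_w (hS : S.Hypotheses P) {k : ℕ} (hk : 1 ≤ k) : mean P (S.w k) = 0 :=
  (mean_eq_integral (hS.secondOrder_w hk)).trans (hS.w_mean k hk)

end Hypotheses

/-! ### Covariances of products of factors from the five independent processes. -/

/-- The σ-algebras of the five mutually independent processes. -/
abbrev sigmas (S : Model Ω nx nz p) : Fin 5 → MeasurableSpace Ω :=
  ![processSigma 1 S.x, processSigma 1 S.gam, processSigma 1 S.v,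
    processSigma 1 S.w, processSigma 1 S.lam]

theorem Hypotheses.sigmas_le (hS : S.Hypotheses P) (i : Fin 5) :
    S.sigmas i ≤ ‹MeasurableSpace Ω› := by
  fin_cases i
  exacts [processSigma_le hS.x_meas, processSigma_le hS.gam_meas,
    processSigma_le fun k _ => hS.measurable_v k, processSigma_le hS.w_meas,
    processSigma_le hS.lam_meas]

/-- A square-integrable product of functions of the five mutually independent processes. -/
structure Factored (S : Model Ω nx nz p) (P : Measure Ω) (X a b c d e : Ω → ℝ) : Prop where
  eq : X = fun ω => a ω * b ω * c ω * d ω * e ω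
  meas_x : Measurable[processSigma 1 S.x] a
  meas_gam : Measurable[processSigma 1 S.gam] b
  meas_v : Measurable[processSigma 1 S.v] c
  meas_w : Measurable[processSigma 1 S.w] d
  meas_lam : Measurable[processSigma 1 S.lam] e
  memLp : MemLp X 2 P

theorem Factored.covariance (hS : S.Hypotheses P) {X a b c d e X' a' b' c' d' e' : Ω → ℝ}
    (h : S.Factored P X a b c d e) (h' : S.Factored P X' a' b' c' d' e') :
    cov[X, X'; P] =
      (∫ ω, a ω * a' ω ∂P) * (∫ ω, b ω * b' ω ∂P) * (∫ ω, c ω * c' ω ∂P) *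
          (∫ ω, d ω * d' ω ∂P) * (∫ ω, e ω * e' ω ∂P) -
        (∫ ω, a ω ∂P) * (∫ ω, b ω ∂P) * (∫ ω, c ω ∂P) * (∫ ω, d ω ∂P) * (∫ ω, e ω ∂P) *
          ((∫ ω, a' ω ∂P) * (∫ ω, b' ω ∂P) * (∫ ω, c' ω ∂P) * (∫ ω, d' ω ∂P) *
            ∫ ω, e' ω ∂P) := by
  rw [covariance_eq_sub h.memLp h'.memLp, h.eq, h'.eq]
  congr 1
  · refine Eq.trans ?_ (integral_mul_of_iIndep (m := S.sigmas) hS.indep hS.sigmas_le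
      (h.meas_x.mul h'.meas_x) (h.meas_gam.mul h'.meas_gam) (h.meas_v.mul h'.meas_v)
      (h.meas_w.mul h'.meas_w) (h.meas_lam.mul h'.meas_lam))
    congr 1
    funext ω
    simp only [Pi.mul_apply]
    ring
  · congr 1
    · exact integral_mul_of_iIndep (m := S.sigmas) hS.indep hS.sigmas_le
        h.meas_x h.meas_gam h.meas_v h.meas_w h.meas_lam
    · exact integral_mul_of_iIndep (m := S.sigmas) hS.indep hS.sigmas_le
        h'.meas_x h'.meas_gam h'.meas_v h'.meas_w h'.meas_lam

/-! ### Covariances of the observations through their signal, noise and attack parts. -/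

/-- The part of `y_k` that depends on the signal. -/
def ySignal (S : Model Ω nx nz p) (k : ℕ) (ω : Ω) : Fin nz → ℝ :=
  (S.gam k ω * (1 - S.lam k ω)) • (S.H k *ᵥ S.x k ω + S.C k)

/-- The part of `y_k` that depends on the time-correlated noise. -/
def yNoise (S : Model Ω nx nz p) (k : ℕ) (ω : Ω) : Fin nz → ℝ :=
  (1 - S.lam k ω) • S.v k ω

/-- The part of `y_k` that depends on the noise of the attacker. -/
def yAttack (S : Model Ω nx nz p) (k : ℕ) (ω : Ω) : Fin nz → ℝ :=
  S.lam k ω • S.w k ω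

theorem y_eq_add (S : Model Ω nx nz p) (k : ℕ) :
    S.y k = fun ω => S.ySignal k ω + S.yNoise k ω + S.yAttack k ω := by
  funext ω i
  simp only [y, z, ySignal, yNoise, yAttack, Pi.add_apply, Pi.smul_apply, smul_eq_mul]
  ring

theorem memLp_top_of_bernoulli {g : Ω → ℝ} (hg : Measurable g)
    (h : ∀ᵐ ω ∂P, g ω = 0 ∨ g ω = 1) : MemLp g ⊤ P := by
  refine memLp_top_of_bound hg.aestronglyMeasurable 1 ?_
  filter_upwards [h] with ω hω
  rcases hω with e | e <;> simp [e]

namespace Hypotheses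

theorem memLp_gam (hS : S.Hypotheses P) {k : ℕ} (hk : 1 ≤ k) : MemLp (S.gam k) ⊤ P :=
  memLp_top_of_bernoulli (hS.gam_meas k hk) (hS.gam_bernoulli k hk)

theorem memLp_lam (hS : S.Hypotheses P) {k : ℕ} (hk : 1 ≤ k) : MemLp (S.lam k) ⊤ P :=
  memLp_top_of_bernoulli (hS.lam_meas k hk) (hS.lam_bernoulli k hk)

theorem integrable_lam (hS : S.Hypotheses P) {k : ℕ} (hk : 1 ≤ k) : Integrable (S.lam k) P :=
  (hS.memLp_lam hk).integrable le_top

theorem memLp_one_sub_lam (hS : S.Hypotheses P) {k : ℕ} (hk : 1 ≤ k) :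
    MemLp (fun ω => 1 - S.lam k ω) ⊤ P :=
  (memLp_const 1).sub (hS.memLp_lam hk)

theorem integral_one_sub_lam (hS : S.Hypotheses P) {k : ℕ} (hk : 1 ≤ k) :
    ∫ ω, (1 - S.lam k ω) ∂P = 1 - S.lamBar P k := by
  rw [integral_sub (integrable_const 1) (hS.integrable_lam hk)]
  simp [lamBar]

theorem integral_gam_mul_gam (hS : S.Hypotheses P) {k j : ℕ} (hk : 1 ≤ k) (hj : 1 ≤ j)
    (h : k ≠ j) : ∫ ω, S.gam k ω * S.gam j ω ∂P = S.gamBar P k * S.gamBar P j := by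
  have hi := hS.gam_indep.indepFun (i := ⟨k, hk⟩) (j := ⟨j, hj⟩) (fun e => h (congrArg Subtype.val e))
  exact hi.integral_fun_mul_eq_mul_integral (hS.gam_meas k hk).aestronglyMeasurable
    (hS.gam_meas j hj).aestronglyMeasurable

theorem integral_one_sub_lam_mul (hS : S.Hypotheses P) {k j : ℕ} (hk : 1 ≤ k) (hj : 1 ≤ j)
    (h : k ≠ j) : ∫ ω, (1 - S.lam k ω) * (1 - S.lam j ω) ∂P =
      (1 - S.lamBar P k) * (1 - S.lamBar P j) := by
  have hi := hS.lam_indep.indepFun (i := ⟨k, hk⟩) (j := ⟨j, hj⟩) (fun e => h (congrArg Subtype.val e))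
  have hm : Measurable fun t : ℝ => 1 - t := measurable_const.sub measurable_id
  rw [← hS.integral_one_sub_lam hk, ← hS.integral_one_sub_lam hj]
  exact (hi.comp hm hm).integral_fun_mul_eq_mul_integral
    (hm.comp (hS.lam_meas k hk)).aestronglyMeasurable
    (hm.comp (hS.lam_meas j hj)).aestronglyMeasurable

theorem secondOrder_measuredSignal (hS : S.Hypotheses P) {k : ℕ} (hk : 1 ≤ k) :
    SecondOrder P fun ω => S.H k *ᵥ S.x k ω + S.C k :=
  ((hS.secondOrder_x hk).mulVec _).add (SecondOrder.const _)

theorem measurable_measuredSignal {k : ℕ} (hk : 1 ≤ k) (i : Fin nz) :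
    Measurable[processSigma 1 S.x] fun ω => (S.H k *ᵥ S.x k ω + S.C k) i := by
  have hc : Continuous fun x : Fin nx → ℝ => (S.H k *ᵥ x + S.C k) i :=
    (continuous_apply i).comp
      ((continuous_const.matrix_mulVec continuous_id).add continuous_const)
  exact hc.measurable.comp (measurable_processSigma S.x hk)

theorem factored_x (hS : S.Hypotheses P) {k : ℕ} (hk : 1 ≤ k) (i : Fin nx) :
    S.Factored P (fun ω => S.x k ω i) (fun ω => S.x k ω i) (fun _ => 1) (fun _ => 1) (fun _ => 1)
      (fun _ => 1) where
  eq := by simp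
  meas_x := (measurable_pi_apply i).comp (measurable_processSigma S.x hk)
  meas_gam := measurable_const
  meas_v := measurable_const
  meas_w := measurable_const
  meas_lam := measurable_const
  memLp := hS.secondOrder_x hk i

theorem factored_ySignal (hS : S.Hypotheses P) {k : ℕ} (hk : 1 ≤ k) (i : Fin nz) :
    S.Factored P (fun ω => S.ySignal k ω i) (fun ω => (S.H k *ᵥ S.x k ω + S.C k) i) (S.gam k)
      (fun _ => 1) (fun _ => 1) (fun ω => 1 - S.lam k ω) where
  eq := by
    funext ω
    simp only [ySignal, Pi.smul_apply, smul_eq_mul]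
    ring
  meas_x := measurable_measuredSignal hk i
  meas_gam := measurable_processSigma S.gam hk
  meas_v := measurable_const
  meas_w := measurable_const
  meas_lam := measurable_const.sub (measurable_processSigma S.lam hk)
  -- The Bernoulli factors are essentially bounded, so multiplying by them preserves
  -- square-integrability.
  memLp := (hS.secondOrder_measuredSignal hk i).mul
    ((hS.memLp_one_sub_lam hk).mul (hS.memLp_gam hk) (r := ⊤))

theorem factored_yNoise (hS : S.Hypotheses P) {k : ℕ} (hk : 1 ≤ k) (i : Fin nz) :
    S.Factored P (fun ω => S.yNoise k ω i) (fun _ => 1) (fun _ => 1) (fun ω => S.v k ω i)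
      (fun _ => 1) (fun ω => 1 - S.lam k ω) where
  eq := by
    funext ω
    simp only [yNoise, Pi.smul_apply, smul_eq_mul]
    ring
  meas_x := measurable_const
  meas_gam := measurable_const
  meas_v := (measurable_pi_apply i).comp (measurable_processSigma S.v hk)
  meas_w := measurable_const
  meas_lam := measurable_const.sub (measurable_processSigma S.lam hk)
  memLp := (hS.secondOrder_v k i).mul (hS.memLp_one_sub_lam hk)

theorem factored_yAttack (hS : S.Hypotheses P) {k : ℕ} (hk : 1 ≤ k) (i : Fin nz) :
    S.Factored P (fun ω => S.yAttack k ω i) (fun _ => 1) (fun _ => 1) (fun _ => 1)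
      (fun ω => S.w k ω i) (S.lam k) where
  eq := by
    funext ω
    simp only [yAttack, Pi.smul_apply, smul_eq_mul]
    ring
  meas_x := measurable_const
  meas_gam := measurable_const
  meas_v := measurable_const
  meas_w := (measurable_pi_apply i).comp (measurable_processSigma S.w hk)
  meas_lam := measurable_processSigma S.lam hk
  memLp := (hS.secondOrder_w hk i).mul (hS.memLp_lam hk)

theorem secondOrder_ySignal (hS : S.Hypotheses P) {k : ℕ} (hk : 1 ≤ k) :
    SecondOrder P (S.ySignal k) := fun i => (hS.factored_ySignal hk i).memLp

theorem secondOrder_yNoise (hS : S.Hypotheses P) {k : ℕ} (hk : 1 ≤ k) :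
    SecondOrder P (S.yNoise k) := fun i => (hS.factored_yNoise hk i).memLp

theorem secondOrder_yAttack (hS : S.Hypotheses P) {k : ℕ} (hk : 1 ≤ k) :
    SecondOrder P (S.yAttack k) := fun i => (hS.factored_yAttack hk i).memLp

theorem secondOrder_y (hS : S.Hypotheses P) (k : ℕ) (hk : 1 ≤ k) : SecondOrder P (S.y k) := by
  rw [y_eq_add]
  exact ((hS.secondOrder_ySignal hk).add (hS.secondOrder_yNoise hk)).add
    (hS.secondOrder_yAttack hk)

theorem integral_v (hS : S.Hypotheses P) (k : ℕ) (i : Fin nz) : ∫ ω, S.v k ω i ∂P = 0 :=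
  congrFun (hS.mean_v k) i

theorem integral_w (hS : S.Hypotheses P) {k : ℕ} (hk : 1 ≤ k) (i : Fin nz) :
    ∫ ω, S.w k ω i ∂P = 0 :=
  congrFun (hS.mean_w hk) i

theorem integral_x (hS : S.Hypotheses P) {k : ℕ} (hk : 1 ≤ k) (i : Fin nx) :
    ∫ ω, S.x k ω i ∂P = 0 :=
  congrFun (hS.mean_x hk) i

theorem integral_measuredSignal (hS : S.Hypotheses P) {k : ℕ} (hk : 1 ≤ k) (i : Fin nz) :
    ∫ ω, (S.H k *ᵥ S.x k ω + S.C k) i ∂P = S.C k i := by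
  have := congrFun (mean_add ((hS.secondOrder_x hk).mulVec (S.H k)) (SecondOrder.const (S.C k))) i
  rwa [mean_mulVec (hS.secondOrder_x hk), hS.mean_x hk, mulVec_zero, mean_const, zero_add] at this

theorem integral_v_mul_v (hS : S.Hypotheses P) (k j : ℕ) (i l : Fin nz) :
    ∫ ω, S.v k ω i * S.v j ω l ∂P = covMat P (S.v k) (S.v j) i l :=
  congrFun (congrFun (expOuter_eq_covMat_of_mean_left (hS.secondOrder_v k) (hS.secondOrder_v j)
    (hS.mean_v k)) i) l

theorem integral_w_mul_w (hS : S.Hypotheses P) {k j : ℕ} (hk : 1 ≤ k) (hj : 1 ≤ j) (h : k ≠ j)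
    (i l : Fin nz) : ∫ ω, S.w k ω i * S.w j ω l ∂P = 0 := by
  have := congrFun (congrFun (expOuter_eq_covMat_of_mean_left (hS.secondOrder_w hk)
    (hS.secondOrder_w hj) (hS.mean_w hk)) i) l
  rwa [hS.w_white k j hk hj h] at this

theorem integral_x_mul_measuredSignal (hS : S.Hypotheses P) {k j : ℕ} (hk : 1 ≤ k) (hj : 1 ≤ j)
    (i : Fin nx) (l : Fin nz) : ∫ ω, S.x k ω i * (S.H j *ᵥ S.x j ω + S.C j) l ∂P =
      (covMat P (S.x k) (S.x j) * (S.H j)ᵀ) i l := by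
  have := congrFun (congrFun (expOuter_eq_covMat_of_mean_left (hS.secondOrder_x hk)
    (hS.secondOrder_measuredSignal hj) (hS.mean_x hk)) i) l
  rwa [covMat_add_right (hS.secondOrder_x hk) ((hS.secondOrder_x hj).mulVec _)
    (SecondOrder.const _), covMat_const_right, add_zero,
    covMat_mulVec_right (hS.secondOrder_x hk) (hS.secondOrder_x hj)] at this

theorem integral_measuredSignal_mul (hS : S.Hypotheses P) {k j : ℕ} (hk : 1 ≤ k) (hj : 1 ≤ j)
    (i l : Fin nz) :
    ∫ ω, (S.H k *ᵥ S.x k ω + S.C k) i * (S.H j *ᵥ S.x j ω + S.C j) l ∂P =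
      (S.H k * covMat P (S.x k) (S.x j) * (S.H j)ᵀ) i l + S.C k i * S.C j l := by
  have hk2 := hS.secondOrder_measuredSignal hk
  have hj2 := hS.secondOrder_measuredSignal hj
  have h1 : covMat P (fun ω => S.H k *ᵥ S.x k ω + S.C k) (fun ω => S.H j *ᵥ S.x j ω + S.C j) =
      S.H k * covMat P (S.x k) (S.x j) * (S.H j)ᵀ := by
    rw [covMat_add_left ((hS.secondOrder_x hk).mulVec _) (SecondOrder.const _) hj2,
      covMat_const_left, add_zero, covMat_mulVec_left (hS.secondOrder_x hk) hj2,
      covMat_add_right (hS.secondOrder_x hk) ((hS.secondOrder_x hj).mulVec _)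
      (SecondOrder.const _), covMat_const_right, add_zero,
      covMat_mulVec_right (hS.secondOrder_x hk) (hS.secondOrder_x hj), Matrix.mul_assoc]
  rw [← h1, covMat, of_apply, covariance_eq_sub (hk2 i) (hj2 l), hS.integral_measuredSignal hk,
    hS.integral_measuredSignal hj]
  simp

/-- At distinct times the Bernoulli moments factor into means, so the contribution of `C_k` and
`C_j` to the second moment cancels against the product of the means. -/
theorem covMat_ySignal_ySignal (hS : S.Hypotheses P) {k j : ℕ} (hk : 1 ≤ k) (hj : 1 ≤ j)
    (h : k ≠ j) : covMat P (S.ySignal k) (S.ySignal j) =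
      ((1 - S.lamBar P k) * (1 - S.lamBar P j) * (S.gamBar P k * S.gamBar P j)) •
        (S.H k * covMat P (S.x k) (S.x j) * (S.H j)ᵀ) := by
  ext i l
  rw [Matrix.smul_apply, smul_eq_mul, covMat_apply (S.ySignal k),
    (hS.factored_ySignal hk i).covariance hS (hS.factored_ySignal hj l),
    hS.integral_measuredSignal_mul hk hj, hS.integral_gam_mul_gam hk hj h,
    hS.integral_one_sub_lam_mul hk hj h, hS.integral_measuredSignal hk,
    hS.integral_measuredSignal hj, hS.integral_one_sub_lam hk, hS.integral_one_sub_lam hj,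
    ← gamBar, ← gamBar]
  simp only [mul_one, integral_const, probReal_univ, one_smul]
  ring

theorem covMat_yNoise_yNoise (hS : S.Hypotheses P) {k j : ℕ} (hk : 1 ≤ k) (hj : 1 ≤ j)
    (h : k ≠ j) : covMat P (S.yNoise k) (S.yNoise j) =
      ((1 - S.lamBar P k) * (1 - S.lamBar P j)) • covMat P (S.v k) (S.v j) := by
  ext i l
  rw [Matrix.smul_apply, smul_eq_mul, covMat_apply (S.yNoise k),
    (hS.factored_yNoise hk i).covariance hS (hS.factored_yNoise hj l),
    hS.integral_v_mul_v, hS.integral_v, hS.integral_one_sub_lam_mul hk hj h]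
  simp only [mul_one, integral_const, probReal_univ, one_smul]
  ring

theorem covMat_yAttack_yAttack (hS : S.Hypotheses P) {k j : ℕ} (hk : 1 ≤ k) (hj : 1 ≤ j)
    (h : k ≠ j) : covMat P (S.yAttack k) (S.yAttack j) = 0 := by
  ext i l
  rw [covMat, of_apply, (hS.factored_yAttack hk i).covariance hS (hS.factored_yAttack hj l),
    hS.integral_w_mul_w hk hj h, hS.integral_w hk]
  simp

/-- The two parts share `λ` when `k = j`, but the zero mean of `v_j` factors out of both terms of
the covariance, so no case distinction is needed. -/
theorem covMat_ySignal_yNoise (hS : S.Hypotheses P) {k j : ℕ} (hk : 1 ≤ k) (hj : 1 ≤ j) :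
    covMat P (S.ySignal k) (S.yNoise j) = 0 := by
  ext i l
  rw [covMat, of_apply, (hS.factored_ySignal hk i).covariance hS (hS.factored_yNoise hj l)]
  simp [hS.integral_v]

theorem covMat_ySignal_yAttack (hS : S.Hypotheses P) {k j : ℕ} (hk : 1 ≤ k) (hj : 1 ≤ j) :
    covMat P (S.ySignal k) (S.yAttack j) = 0 := by
  ext i l
  rw [covMat, of_apply, (hS.factored_ySignal hk i).covariance hS (hS.factored_yAttack hj l)]
  simp [hS.integral_w hj]

theorem covMat_yNoise_yAttack (hS : S.Hypotheses P) {k j : ℕ} (hk : 1 ≤ k) (hj : 1 ≤ j) :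
    covMat P (S.yNoise k) (S.yAttack j) = 0 := by
  ext i l
  rw [covMat, of_apply, (hS.factored_yNoise hk i).covariance hS (hS.factored_yAttack hj l)]
  simp [hS.integral_w hj]

theorem covMat_x_ySignal (hS : S.Hypotheses P) {k j : ℕ} (hk : 1 ≤ k) (hj : 1 ≤ j) :
    covMat P (S.x k) (S.ySignal j) =
      ((1 - S.lamBar P j) * S.gamBar P j) • (covMat P (S.x k) (S.x j) * (S.H j)ᵀ) := by
  ext i l
  rw [Matrix.smul_apply, smul_eq_mul, ← hS.integral_x_mul_measuredSignal hk hj,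
    covMat_apply (S.x k),
    (hS.factored_x hk i).covariance hS (hS.factored_ySignal hj l), hS.integral_x hk]
  simp only [mul_one, one_mul, integral_const, probReal_univ, one_smul,
    hS.integral_one_sub_lam hj, gamBar]
  ring

theorem covMat_x_yNoise (hS : S.Hypotheses P) {k j : ℕ} (hk : 1 ≤ k) (hj : 1 ≤ j) :
    covMat P (S.x k) (S.yNoise j) = 0 := by
  ext i l
  rw [covMat, of_apply, (hS.factored_x hk i).covariance hS (hS.factored_yNoise hj l)]
  simp [hS.integral_v]

theorem covMat_x_yAttack (hS : S.Hypotheses P) {k j : ℕ} (hk : 1 ≤ k) (hj : 1 ≤ j) :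
    covMat P (S.x k) (S.yAttack j) = 0 := by
  ext i l
  rw [covMat, of_apply, (hS.factored_x hk i).covariance hS (hS.factored_yAttack hj l)]
  simp [hS.integral_w hj]

theorem covMat_x_y (hS : S.Hypotheses P) {k j : ℕ} (hk : 1 ≤ k) (hj : 1 ≤ j) :
    covMat P (S.x k) (S.y j) =
      ((1 - S.lamBar P j) * S.gamBar P j) • (covMat P (S.x k) (S.x j) * (S.H j)ᵀ) := by
  rw [y_eq_add, covMat_add_right (hS.secondOrder_x hk)
    ((hS.secondOrder_ySignal hj).add (hS.secondOrder_yNoise hj)) (hS.secondOrder_yAttack hj),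
    covMat_add_right (hS.secondOrder_x hk) (hS.secondOrder_ySignal hj) (hS.secondOrder_yNoise hj),
    hS.covMat_x_ySignal hk hj, hS.covMat_x_yNoise hk hj, hS.covMat_x_yAttack hk hj, add_zero,
    add_zero]

theorem covMat_x_y_of_le (hS : S.Hypotheses P) {k j : ℕ} (hj : 1 ≤ j) (h : j ≤ k) :
    covMat P (S.x k) (S.y j) = (1 - S.lamBar P j) • (S.A k * (S.Gam P j .x)ᵀ) := by
  rw [hS.covMat_x_y (hj.trans h) hj, hS.x_cov k j hj h, Gam, transpose_smul, transpose_mul,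
    Matrix.mul_smul, smul_smul, Matrix.mul_assoc]

/-- Here the signal time comes first, so the symmetric form `B_k A_jᵀ` of the signal covariance
applies; it is the source of `B_k` in the smoother gain. -/
theorem covMat_x_y_of_ge (hS : S.Hypotheses P) {k j : ℕ} (hk : 1 ≤ k) (h : k ≤ j) :
    covMat P (S.x k) (S.y j) = (1 - S.lamBar P j) • (S.B k * (S.Del P j .x)ᵀ) := by
  rw [hS.covMat_x_y hk (hk.trans h), hS.covMat_x_comm hk h, Del, transpose_smul, transpose_mul,
    Matrix.mul_smul, smul_smul, Matrix.mul_assoc]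

theorem covMat_y_y (hS : S.Hypotheses P) {k j : ℕ} (hj : 1 ≤ j) (h : j < k) :
    covMat P (S.y k) (S.y j) = ((1 - S.lamBar P k) * (1 - S.lamBar P j)) •
      (S.Del P k .x * (S.Gam P j .x)ᵀ + S.Del P k .v * (S.Gam P j .v)ᵀ) := by
  have hk : 1 ≤ k := hj.trans h.le
  have a1 := hS.secondOrder_ySignal hk
  have a2 := hS.secondOrder_yNoise hk
  have a3 := hS.secondOrder_yAttack hk
  have b1 := hS.secondOrder_ySignal hj
  have b2 := hS.secondOrder_yNoise hj
  have b3 := hS.secondOrder_yAttack hj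
  have b := (b1.add b2).add b3
  -- Nine blocks arise. The mixed ones vanish, some only after transposing, and whiteness removes
  -- the attack block because `j < k`.
  rw [y_eq_add, y_eq_add, covMat_add_left (a1.add a2) a3 b, covMat_add_left a1 a2 b,
    covMat_add_right a1 (b1.add b2) b3, covMat_add_right a1 b1 b2,
    covMat_add_right a2 (b1.add b2) b3, covMat_add_right a2 b1 b2,
    covMat_add_right a3 (b1.add b2) b3, covMat_add_right a3 b1 b2,
    ← transpose_covMat (S.ySignal j) (S.yNoise k), ← transpose_covMat (S.ySignal j) (S.yAttack k),
    ← transpose_covMat (S.yNoise j) (S.yAttack k),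
    hS.covMat_ySignal_yNoise hk hj, hS.covMat_ySignal_yAttack hk hj, hS.covMat_yNoise_yAttack hk hj,
    hS.covMat_ySignal_yNoise hj hk, hS.covMat_ySignal_yAttack hj hk, hS.covMat_yNoise_yAttack hj hk,
    hS.covMat_yAttack_yAttack hk hj h.ne', hS.covMat_yNoise_yNoise hk hj h.ne',
    hS.covMat_ySignal_ySignal hk hj h.ne', hS.covMat_v h.le, hS.x_cov k j hj h.le]
  simp only [transpose_zero, add_zero, zero_add, Gam, Del, transpose_smul, transpose_mul,
    Matrix.mul_smul, Matrix.smul_mul, smul_add, smul_smul, Matrix.mul_assoc]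
  congr 2
  ring

end Hypotheses

end Model

/-! ### Transfer of separable covariances to innovations. -/

namespace Model

variable {nx nz p : ℕ} {S : Model Ω nx nz p} {P : Measure Ω} [IsProbabilityMeasure P]

theorem transpose_innovCov (j : ℕ) : (S.innovCov P j)ᵀ = S.innovCov P j :=
  transpose_covMat _ _

theorem transpose_T (k : ℕ) (a b : Src) : (S.T P k a b)ᵀ = S.T P k b a := by
  induction k with
  | zero => rfl
  | succ k ih =>
    simp only [T, transpose_add, ih, transpose_mul, transpose_transpose, transpose_nonsing_inv,
      transpose_innovCov, Matrix.mul_assoc]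

theorem transpose_Psi (k : ℕ) (a : Src) : (S.Psi P k a)ᵀ = (1 - S.lamBar P k) •
    (S.Gam P k a - S.Del P k .x * S.T P (k - 1) .x a - S.Del P k .v * S.T P (k - 1) .v a) := by
  rw [Psi, psiOf, transpose_smul, transpose_transpose]

theorem T_succ (k : ℕ) (a b : Src) : S.T P (k + 1) a b = S.T P k a b +
    S.Psi P (k + 1) a * (S.innovCov P (k + 1))⁻¹ * (S.Psi P (k + 1) b)ᵀ := rfl

namespace Hypotheses

variable (hS : S.Hypotheses P) (hη : ∀ j, 1 ≤ j → IsUnit (S.innovCov P j).det)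

include hS hη

theorem secondOrder_innov {j : ℕ} (h : 1 ≤ j) : SecondOrder P (S.innov P j) :=
  secondOrder_innovation hS.secondOrder_y hη h

theorem e_mem_linearEstimators (a : Src) (L : ℕ) :
    S.e P a L ∈ linearEstimators S.y L (dim nz p a) := by
  induction L with
  | zero => exact const_mem_linearEstimators 0 0
  | succ L ih =>
    exact add_mem_linearEstimators (linearEstimators_mono (Nat.le_succ L) ih)
      (mulVec_mem_linearEstimators
        (innovation_mem_linearEstimators hS.secondOrder_y hη (by omega)) _)

theorem secondOrder_e (a : Src) (L : ℕ) : SecondOrder P (S.e P a L) :=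
  secondOrder_of_mem_linearEstimators hS.secondOrder_y (hS.e_mem_linearEstimators hη a L)

theorem mean_e (a : Src) (L : ℕ) : mean P (S.e P a L) = 0 := by
  induction L with
  | zero => exact mean_const 0
  | succ L ih =>
    have h := hS.secondOrder_innov hη (j := L + 1) (by omega)
    refine (mean_add (hS.secondOrder_e hη a L) (h.mulVec _)).trans ?_
    have h0 : mean P (S.innov P (L + 1)) = 0 := mean_innovation hS.secondOrder_y hη (by omega)
    rw [mean_mulVec h, h0, ih, mulVec_zero, add_zero]

theorem covMat_e_succ {n : ℕ} {ζ : Ω → Fin n → ℝ} (hζ : SecondOrder P ζ) (b : Src) (L : ℕ) :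
    covMat P ζ (S.e P b (L + 1)) = covMat P ζ (S.e P b L) +
      covMat P ζ (S.innov P (L + 1)) * (S.innovCov P (L + 1))⁻¹ * (S.Psi P (L + 1) b)ᵀ := by
  have h := hS.secondOrder_innov hη (j := L + 1) (by omega)
  refine (covMat_add_right hζ (hS.secondOrder_e hη b L) (h.mulVec _)).trans ?_
  rw [covMat_mulVec_right hζ h, transpose_mul, transpose_nonsing_inv, transpose_innovCov,
    Matrix.mul_assoc]

/-- `e^b_L` is the sum of `Ψ^b_i Σ_i⁻¹ η_i`, so pulling `G` out of each covariance leaves exactly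
the sums that define `T`. -/
theorem covMat_e_eq {n : ℕ} {ζ : Ω → Fin n → ℝ} (hζ : SecondOrder P ζ) (L : ℕ)
    {G : (a : Src) → Matrix (Fin n) (Fin (dim nz p a)) ℝ}
    (h : ∀ i, 1 ≤ i → i ≤ L →
      covMat P ζ (S.innov P i) = G .x * S.Psi P i .x + G .v * S.Psi P i .v) (b : Src) :
    covMat P ζ (S.e P b L) = G .x * S.T P L .x b + G .v * S.T P L .v b := by
  induction L with
  | zero =>
    rw [T, Matrix.mul_zero, Matrix.mul_zero, add_zero]
    exact covMat_const_right ζ 0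
  | succ L ih =>
    rw [hS.covMat_e_succ hη hζ, ih fun i h1 hi => h i h1 (by omega), h (L + 1) (by omega) le_rfl,
      T_succ, T_succ]
    simp only [Matrix.add_mul, Matrix.mul_add, Matrix.mul_assoc]
    abel

/-- In the innovation expansion of the estimator, with terms `Cov[ζ, η_i] Σ_i⁻¹ η_i`, the common
factor `G` comes out and leaves the sums that define `e^x` and `e^v`. -/
theorem lsEstimator_ae_eq {n : ℕ} {ζ : Ω → Fin n → ℝ} (hζ : SecondOrder P ζ) (L : ℕ)
    {G : (a : Src) → Matrix (Fin n) (Fin (dim nz p a)) ℝ}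
    (h : ∀ i, 1 ≤ i → i ≤ L →
      covMat P ζ (S.innov P i) = G .x * S.Psi P i .x + G .v * S.Psi P i .v) :
    lsEstimator P S.y L ζ =ᵐ[P] fun ω =>
      mean P ζ + (G .x *ᵥ S.e P .x L ω + G .v *ᵥ S.e P .v L ω) := by
  induction L with
  | zero =>
    refine (lsEstimator_zero hS.secondOrder_y hζ).trans (ae_of_all _ fun ω => ?_)
    simp only [e, Pi.zero_apply, mulVec_zero, add_zero]
  | succ L ih =>
    filter_upwards [ih fun i h1 hi => h i h1 (by omega),
      lsEstimator_succ hS.secondOrder_y hη L hζ] with ω h1 h2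
    rw [h2, h1]
    change _ + (covMat P ζ (S.innov P (L + 1)) * (S.innovCov P (L + 1))⁻¹) *ᵥ
      S.innov P (L + 1) ω = _
    rw [h (L + 1) (by omega) le_rfl]
    simp only [e, Matrix.add_mul, mulVec_add, add_mulVec, mulVec_mulVec, Matrix.mul_assoc]
    abel

/-- The covariance with an innovation, when the one-stage predictor of the observation is known to
be a linear function of the vectors `e^x` and `e^v`. -/
theorem covMat_innov_of_forall_lt {n : ℕ} {ζ : Ω → Fin n → ℝ} (hζ : SecondOrder P ζ) {j : ℕ}
    (hj : 1 ≤ j) (h : ∀ i, 1 ≤ i → i < j → covMat P (S.y j) (S.innov P i) =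
      ((1 - S.lamBar P j) • S.Del P j .x) * S.Psi P i .x +
        ((1 - S.lamBar P j) • S.Del P j .v) * S.Psi P i .v) :
    covMat P ζ (S.innov P j) = covMat P ζ (S.y j) - (1 - S.lamBar P j) •
      (covMat P ζ (S.e P .x (j - 1)) * (S.Del P j .x)ᵀ +
        covMat P ζ (S.e P .v (j - 1)) * (S.Del P j .v)ᵀ) := by
  have hyj := hS.secondOrder_y j hj
  have hls := hS.lsEstimator_ae_eq hη hyj (j - 1)
    (G := fun a => (1 - S.lamBar P j) • S.Del P j a) fun i h1 hi => h i h1 (by omega)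
  have hx := hS.secondOrder_e hη .x (j - 1)
  have hv := hS.secondOrder_e hη .v (j - 1)
  have hxv := (hx.mulVec ((1 - S.lamBar P j) • S.Del P j .x)).add
    (hv.mulVec ((1 - S.lamBar P j) • S.Del P j .v))
  have hc : SecondOrder P fun _ => mean P (S.y j) := SecondOrder.const _
  have hin : S.innov P j = fun ω => S.y j ω - lsEstimator P S.y (j - 1) (S.y j) ω := rfl
  rw [hin, covMat_sub_right hζ hyj ((hc.add hxv).congr hls.symm), covMat_congr_right hls,
    covMat_add_right hζ hc hxv, covMat_const_right, zero_add,
    covMat_add_right hζ (hx.mulVec _) (hv.mulVec _), covMat_mulVec_right hζ hx,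
    covMat_mulVec_right hζ hv, transpose_smul, transpose_smul, Matrix.mul_smul, Matrix.mul_smul,
    smul_add]

/-- The central induction. `ζ`, its dimension and `G` are quantified inside it because the
hypothesis at earlier times serves two vectors: `y_j` with `G = (1 - λ̄_j) Δ_j`, which identifies
the predictor of `y_j`, and `ζ` itself, which gives the covariances of `ζ` with `e^x_{j-1}` and
`e^v_{j-1}`. -/
theorem covMat_innov_eq (j : ℕ) : ∀ {n : ℕ} {ζ : Ω → Fin n → ℝ}
    (G : (a : Src) → Matrix (Fin n) (Fin (dim nz p a)) ℝ), 1 ≤ j → SecondOrder P ζ →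
    (∀ i, 1 ≤ i → i ≤ j → covMat P ζ (S.y i) =
      (1 - S.lamBar P i) • (G .x * (S.Gam P i .x)ᵀ + G .v * (S.Gam P i .v)ᵀ)) →
    covMat P ζ (S.innov P j) = G .x * S.Psi P j .x + G .v * S.Psi P j .v := by
  induction j using Nat.strong_induction_on with
  | _ j ih =>
  intro n ζ G hj hζ h
  have hyi : ∀ i, 1 ≤ i → i < j → covMat P (S.y j) (S.innov P i) =
      ((1 - S.lamBar P j) • S.Del P j .x) * S.Psi P i .x +
        ((1 - S.lamBar P j) • S.Del P j .v) * S.Psi P i .v := fun i h1 hi =>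
    ih i hi (fun a => (1 - S.lamBar P j) • S.Del P j a) h1 (hS.secondOrder_y j hj)
      fun r hr1 hr => by
        rw [hS.covMat_y_y hr1 (hr.trans_lt hi), Matrix.smul_mul, Matrix.smul_mul, ← smul_add,
          smul_smul, mul_comm]
  have hlt : ∀ i, 1 ≤ i → i ≤ j - 1 →
      covMat P ζ (S.innov P i) = G .x * S.Psi P i .x + G .v * S.Psi P i .v := fun i h1 hi =>
    ih i (by omega) G h1 hζ fun r hr1 hr => h r hr1 (by omega)
  -- After substitution both sides are `G` times the bracket defining `Ψ_j`, up to the symmetry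
  -- `(T^{ab})ᵀ = T^{ba}`.
  rw [hS.covMat_innov_of_forall_lt hη hζ hj hyi, h j hj le_rfl, hS.covMat_e_eq hη hζ _ hlt,
    hS.covMat_e_eq hη hζ _ hlt, ← transpose_transpose (S.Psi P j .x),
    ← transpose_transpose (S.Psi P j .v), transpose_Psi, transpose_Psi]
  simp only [transpose_smul, transpose_sub, transpose_mul, Matrix.mul_smul,
    Matrix.mul_sub, Matrix.add_mul, Matrix.mul_assoc, ← smul_add, ← smul_sub]
  rw [transpose_T (j - 1) .x .x, transpose_T (j - 1) .x .v, transpose_T (j - 1) .v .x,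
    transpose_T (j - 1) .v .v]
  congr 1
  abel

/-- No factorization of the covariances of `ζ` is assumed: the predictor formula concerns `y_j`
alone. This makes it applicable to `x_k` beyond time `k`. -/
theorem covMat_innov {n : ℕ} {ζ : Ω → Fin n → ℝ} (hζ : SecondOrder P ζ) {j : ℕ} (hj : 1 ≤ j) :
    covMat P ζ (S.innov P j) = covMat P ζ (S.y j) - (1 - S.lamBar P j) •
      (covMat P ζ (S.e P .x (j - 1)) * (S.Del P j .x)ᵀ +
        covMat P ζ (S.e P .v (j - 1)) * (S.Del P j .v)ᵀ) :=
  hS.covMat_innov_of_forall_lt hη hζ hj fun i h1 hi =>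
    hS.covMat_innov_eq hη i (fun a => (1 - S.lamBar P j) • S.Del P j a) h1 (hS.secondOrder_y j hj)
      fun r hr1 hr => by
        rw [hS.covMat_y_y hr1 (hr.trans_lt hi), Matrix.smul_mul, Matrix.smul_mul, ← smul_add,
          smul_smul, mul_comm]

/-! ### The filter and smoother matrices. -/

theorem M_eq_covMat {k : ℕ} (hk : 1 ≤ k) (a : Src) (L : ℕ) :
    S.M P a k L = covMat P (S.x k) (S.e P a L) :=
  expOuter_eq_covMat_of_mean_left (hS.secondOrder_x hk) (hS.secondOrder_e hη a L) (hS.mean_x hk)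

theorem crossInnov_eq_covMat {k L : ℕ} (hk : 1 ≤ k) (hL : 1 ≤ L) :
    S.crossInnov P k L = covMat P (S.x k) (S.innov P L) :=
  expOuter_eq_covMat_of_mean_left (hS.secondOrder_x hk) (hS.secondOrder_innov hη hL) (hS.mean_x hk)

theorem M_succ {k : ℕ} (hk : 1 ≤ k) (a : Src) (L : ℕ) :
    S.M P a k (L + 1) = S.M P a k L +
      S.crossInnov P k (L + 1) * (S.innovCov P (L + 1))⁻¹ * (S.Psi P (L + 1) a)ᵀ := by
  rw [hS.M_eq_covMat hη hk, hS.M_eq_covMat hη hk, hS.crossInnov_eq_covMat hη hk (by omega),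
    hS.covMat_e_succ hη (hS.secondOrder_x hk)]

theorem M_self {k : ℕ} (hk : 1 ≤ k) (a : Src) : S.M P a k k = S.A k * S.T P k .x a := by
  -- Up to time `k` the signal is correlated with the observations through `A_k Γ^xᵀ` only, so the
  -- `v` component is zero.
  let G : (a : Src) → Matrix (Fin nx) (Fin (dim nz p a)) ℝ := fun
    | .x => S.A k
    | .v => 0
  have h := hS.covMat_e_eq hη (hS.secondOrder_x hk) k (G := G)
    (fun i h1 hi => hS.covMat_innov_eq hη i G h1 (hS.secondOrder_x hk) fun r hr1 hr => by
      rw [hS.covMat_x_y_of_le hr1 (hr.trans hi), show G .v = 0 from rfl, Matrix.zero_mul,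
        add_zero]) a
  rw [hS.M_eq_covMat hη hk, h, show G .v = 0 from rfl, Matrix.zero_mul, add_zero]

theorem crossInnov_eq {k L : ℕ} (hk : 1 ≤ k) (h : k ≤ L) :
    S.crossInnov P k L = (1 - S.lamBar P L) •
      ((S.B k - S.M P .x k (L - 1)) * (S.Del P L .x)ᵀ -
        S.M P .v k (L - 1) * (S.Del P L .v)ᵀ) := by
  rw [hS.crossInnov_eq_covMat hη hk (hk.trans h),
    hS.covMat_innov hη (hS.secondOrder_x hk) (hk.trans h), hS.covMat_x_y_of_ge hk h,
    ← hS.M_eq_covMat hη hk, ← hS.M_eq_covMat hη hk, ← smul_sub, Matrix.sub_mul, sub_sub]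

theorem covMat_e_e (k : ℕ) (a b : Src) : covMat P (S.e P a k) (S.e P b k) = S.T P k a b := by
  induction k with
  | zero => exact covMat_const_left 0 _
  | succ k ih =>
    have hin := hS.secondOrder_innov hη (j := k + 1) (by omega)
    have ha := hS.secondOrder_e hη a
    have hb := hS.secondOrder_e hη b k
    have horth : ∀ c : Src, covMat P (S.innov P (k + 1)) (S.e P c k) = 0 := fun c =>
      covMat_innovation_eq_zero hS.secondOrder_y hη (by omega) (hS.e_mem_linearEstimators hη c k)
    have hleft : ∀ {n : ℕ} {Y : Ω → Fin n → ℝ}, SecondOrder P Y →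
        covMat P (S.e P a (k + 1)) Y = covMat P (S.e P a k) Y +
          S.Psi P (k + 1) a * (S.innovCov P (k + 1))⁻¹ * covMat P (S.innov P (k + 1)) Y :=
      fun hY => (covMat_add_left (ha k) (hin.mulVec _) hY).trans
        (by rw [covMat_mulVec_left hin hY])
    -- The new innovation is uncorrelated with both `e^a_k` and `e^b_k`; the surviving increment is
    -- `Ψ^a Σ⁻¹ Σ Σ⁻¹ (Ψ^b)ᵀ`, and one pair `Σ⁻¹ Σ` cancels.
    rw [hS.covMat_e_succ hη (ha (k + 1)), hleft hb, hleft hin, ih, horth, ← transpose_covMat,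
      horth, transpose_zero, zero_add, Matrix.mul_zero, add_zero, ← innovCov,
      Matrix.mul_assoc (S.Psi P (k + 1) a), Matrix.nonsing_inv_mul _ (hη (k + 1) (by omega)),
      Matrix.mul_one, T_succ]

theorem xhat_succ {k : ℕ} (hk : 1 ≤ k) (L : ℕ) :
    S.xhat P k (L + 1) =ᵐ[P] fun ω => S.xhat P k L ω +
      (S.crossInnov P k (L + 1) * (S.innovCov P (L + 1))⁻¹) *ᵥ S.innov P (L + 1) ω := by
  rw [hS.crossInnov_eq_covMat hη hk (by omega)]
  exact lsEstimator_succ hS.secondOrder_y hη L (hS.secondOrder_x hk)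

end Hypotheses

end Model

end UncertainObs

end

theorem theorem2 {Ω : Type*} [MeasurableSpace Ω] (P : Measure Ω) [IsProbabilityMeasure P]
    {nx nz p : ℕ} (S : UncertainObs.Model Ω nx nz p) (hS : S.Hypotheses P)
    (hη : ∀ j, 1 ≤ j → IsUnit (S.innovCov P j).det)
    (k : ℕ) (hk : 1 ≤ k) :
    (∀ L, k < L →
      S.xhat P k L =ᵐ[P] fun ω =>
        S.xhat P k (L - 1) ω + (S.crossInnov P k L * (S.innovCov P L)⁻¹) *ᵥ S.innov P L ω) ∧
    (∀ L, k < L →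
      S.crossInnov P k L = (1 - S.lamBar P L) •
        ((S.B k - S.M P .x k (L - 1)) * (S.Del P L .x)ᵀ - S.M P .v k (L - 1) * (S.Del P L .v)ᵀ)) ∧
    (∀ a L, k < L →
      S.M P a k L =
        S.M P a k (L - 1) + S.crossInnov P k L * (S.innovCov P L)⁻¹ * (S.Psi P L a)ᵀ) ∧
    (∀ a, S.M P a k k = S.A k * S.T P k .x a) ∧
    (∀ a b, S.T P k a b = UncertainObs.expOuter P (S.e P a k) (S.e P b k)) := by
  refine ⟨fun L hL => ?_, fun L hL => hS.crossInnov_eq hη hk hL.le, fun a L hL => ?_,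
    hS.M_self hη hk, fun a b => ?_⟩
  -- Writing the index as `k + L + 1` makes its predecessor `k + L` by definition, so the successor
  -- form applies.
  · obtain ⟨L, rfl⟩ := Nat.exists_eq_add_of_lt hL
    exact hS.xhat_succ hη hk (k + L)
  · obtain ⟨L, rfl⟩ := Nat.exists_eq_add_of_lt hL
    exact hS.M_succ hη hk a (k + L)
  · rw [UncertainObs.expOuter_eq_covMat_of_mean_left (hS.secondOrder_e hη a k)
      (hS.secondOrder_e hη b k) (hS.mean_e hη a k), hS.covMat_e_e hη]
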